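/- Graphs are finite and simple. A fixed-edge-free involution of a graph $G$ is an automorphism $\varphi$ of $G$ of order exactly $2$ such that $\{\varphi(u),\varphi(v)\}\neq\{u,v\}$ for every edge $\{u,v\}$ of $G$. Permuted Automorphism Reconstruction (PAR) is the following search problem. Input: two isomorphic graphs $G$ and $H$ and a fixed-edge-free involution $\beta$ of $H$. Find: a fixed-edge-free involution $\alpha$ of $G$. Graph Isomorphism (GI) is the following decision problem. Input: two graphs $G_0$ and $G_1$. Decide whether $G_0$ and $G_1$ are isomorphic. A problem $P$ is polynomial-time Turing reducible to a problem $Q$ if there are an oracle algorithm $M$ and a polynomial $p$ such that, for every oracle that returns a correct answer on each input of $Q$ (and is arbitrary on all other strings), $M$ with this oracle returns, on every input $x$ of $P$, a correct answer within $p(|x|)$ steps. Here graphs are given by adjacency matrices and permutations by permutation matrices. Theorem. PAR and GI are polynomial-time equivalent: PAR is polynomial-time Turing reducible to GI, and GI is polynomial-time Turing reducible to PAR. -/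

import Mathlib

/-! ### Oracle random access machines

Structured programs for a random access machine with addition and truncated subtraction, finitely
many registers and finitely many arrays, and access to a string oracle. Every elementary
instruction and every test costs one step; an oracle call also costs one step for each symbol of
the query, and the answer is then available at once. (No multiplication or shift is
available, so a number produced within `t` steps has `O(t)` bits more than the constants of the
program, and the unit cost measure is polynomially related to Turing machine time.) -/

namespace OracleRAM

/-- Programs. Registers and arrays are named by natural numbers; constants are fixed in the text
of the program. -/
inductive Prog : Type
  /-- `reg r := k` -/
  | const (r k : ℕ)
  /-- `reg r := reg a + reg b` -/
  | add (r a b : ℕ)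
  /-- `reg r := reg a - reg b`, truncated at `0` -/
  | sub (r a b : ℕ)
  /-- `reg r := A[reg i]` -/
  | load (r A i : ℕ)
  /-- `A[reg i] := reg r` -/
  | store (A i r : ℕ)
  /-- call the oracle on the string written in array `Q`; the answer is written into array `A` -/
  | query (Q A : ℕ)
  /-- sequential composition -/
  | seq (c d : Prog)
  /-- run `c` if `reg r ≠ 0`, and `d` otherwise -/
  | ite (r : ℕ) (c d : Prog)
  /-- as long as `reg r ≠ 0`, run `c` -/
  | loop (r : ℕ) (c : Prog)

/-- Contents of the registers, and of the arrays: `mem A i` is the cell `A[i]`. -/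
@[ext]
structure State : Type where
  reg : ℕ → ℕ
  mem : ℕ → ℕ → ℕ

namespace State

def setReg (s : State) (r v : ℕ) : State :=
  { s with reg := Function.update s.reg r v }

def setArray (s : State) (A : ℕ) (f : ℕ → ℕ) : State :=
  { s with mem := Function.update s.mem A f }

def setCell (s : State) (A i v : ℕ) : State :=
  s.setArray A (Function.update (s.mem A) i v)

end State

/-- A bit string as the contents of an array: `1` stands for the bit `false`, `2` for the bit
`true`, and all cells behind the end of the string are blank, that is, `0`. -/
def cells (w : List Bool) (i : ℕ) : ℕ :=
  match w[i]? with
  | none => 0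
  | some false => 1
  | some true => 2

/-- The string `w` is written in the array `f`, from cell `0` up to the first blank. -/
def Holds (f : ℕ → ℕ) (w : List Bool) : Prop :=
  ∀ i ≤ w.length, f i = cells w i

/-- `Exec O c s s' t`: with oracle `O`, the program `c` started in state `s` halts after exactly
`t` steps, in state `s'`. -/
inductive Exec (O : List Bool → List Bool) : Prog → State → State → ℕ → Prop
  | const (s : State) (r k : ℕ) : Exec O (.const r k) s (s.setReg r k) 1
  | add (s : State) (r a b : ℕ) : Exec O (.add r a b) s (s.setReg r (s.reg a + s.reg b)) 1
  | sub (s : State) (r a b : ℕ) : Exec O (.sub r a b) s (s.setReg r (s.reg a - s.reg b)) 1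
  | load (s : State) (r A i : ℕ) : Exec O (.load r A i) s (s.setReg r (s.mem A (s.reg i))) 1
  | store (s : State) (A i r : ℕ) : Exec O (.store A i r) s (s.setCell A (s.reg i) (s.reg r)) 1
  | query (s : State) (Q A : ℕ) (w : List Bool) (hw : Holds (s.mem Q) w) :
      Exec O (.query Q A) s (s.setArray A (cells (O w))) (w.length + 1)
  | seq {c d : Prog} {s s' s'' : State} {t t' : ℕ} (hc : Exec O c s s' t)
      (hd : Exec O d s' s'' t') : Exec O (.seq c d) s s'' (t + t')
  | ite_true {r : ℕ} {c d : Prog} {s s' : State} {t : ℕ} (hr : s.reg r ≠ 0)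
      (hc : Exec O c s s' t) : Exec O (.ite r c d) s s' (t + 1)
  | ite_false {r : ℕ} {c d : Prog} {s s' : State} {t : ℕ} (hr : s.reg r = 0)
      (hd : Exec O d s s' t) : Exec O (.ite r c d) s s' (t + 1)
  | loop_true {r : ℕ} {c : Prog} {s s' s'' : State} {t t' : ℕ} (hr : s.reg r ≠ 0)
      (hc : Exec O c s s' t) (hw : Exec O (.loop r c) s' s'' t') :
      Exec O (.loop r c) s s'' (t + t' + 1)
  | loop_false {r : ℕ} {c : Prog} {s : State} (hr : s.reg r = 0) :
      Exec O (.loop r c) s s 1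

/-- The initial state on input `x`: the input is written in array `0`; all else is `0`. -/
def initState (x : List Bool) : State :=
  State.setArray ⟨fun _ => 0, fun _ _ => 0⟩ 0 (cells x)

/-- With oracle `O`, the program `c` on input `x` halts within `T` steps with the string `y`
written in the output array `1`. -/
def Outputs (O : List Bool → List Bool) (c : Prog) (x y : List Bool) (T : ℕ) : Prop :=
  ∃ s t, Exec O c (initState x) s t ∧ t ≤ T ∧ Holds (s.mem 1) y

end OracleRAM

/-! ### Search problems and polynomial-time Turing reductions -/

/-- A search problem: instances, their encoding by bit strings, and the set of strings that are
correct answers to an instance. (A decision problem is the special case in which the one correct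
answer is the truth value.) -/
structure SearchProblem : Type 1 where
  Inst : Type
  encode : Inst → List Bool
  encode_injective : Function.Injective encode
  IsAnswer : Inst → List Bool → Prop

/-- The oracle `O` solves `P`: it answers every instance correctly. Nothing is assumed about its
answers to strings that do not encode an instance. -/
def SearchProblem.SolvedBy (P : SearchProblem) (O : List Bool → List Bool) : Prop :=
  ∀ I : P.Inst, P.IsAnswer I (O (P.encode I))

/-- Polynomial-time Turing reducibility: one program solves `P` in polynomial time, whatever the
oracle solving `Q` that it is given. -/
def PolyTimeTuringReducible (P Q : SearchProblem) : Prop :=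
  ∃ (c : OracleRAM.Prog) (p : Polynomial ℕ), ∀ O : List Bool → List Bool, Q.SolvedBy O →
    ∀ I : P.Inst, ∃ y : List Bool, P.IsAnswer I y ∧
      OracleRAM.Outputs O c (P.encode I) y (p.eval (P.encode I).length)

def PolyTimeEquivalent (P Q : SearchProblem) : Prop :=
  PolyTimeTuringReducible P Q ∧ PolyTimeTuringReducible Q P

/-! ### Encodings of graphs and permutations -/

open Classical in
/-- The `n × n` matrix of a binary relation, row by row. -/
noncomputable def matrixBits {n : ℕ} (r : Fin n → Fin n → Prop) : List Bool :=
  List.ofFn fun k : Fin (n * n) => decide (r k.divNat k.modNat)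

/-- A graph is encoded by its number of vertices in unary, a separator and its adjacency matrix. -/
noncomputable def graphCode {n : ℕ} (G : SimpleGraph (Fin n)) : List Bool :=
  List.replicate n true ++ false :: matrixBits G.Adj

/-- A permutation is encoded by its permutation matrix. -/
noncomputable def permCode {n : ℕ} (α : Equiv.Perm (Fin n)) : List Bool :=
  matrixBits fun i j => α i = j

theorem matrixBits_injective {n : ℕ} : Function.Injective (@matrixBits n) := by
  intro r r' h
  have h' := List.ofFn_injective h
  funext i j
  have h2 := congrFun h' (finProdFinEquiv (i, j))
  have h3 : (finProdFinEquiv (i, j)).divNat = i ∧ (finProdFinEquiv (i, j)).modNat = j := by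
    have := finProdFinEquiv.symm_apply_apply (i, j)
    exact ⟨congrArg Prod.fst this, congrArg Prod.snd this⟩
  rw [h3.1, h3.2] at h2
  simpa using h2

theorem unary_append_injective {n m : ℕ} {s t : List Bool}
    (h : List.replicate n true ++ false :: s = List.replicate m true ++ false :: t) :
    n = m ∧ s = t := by
  induction n generalizing m with
  | zero => cases m <;> simp_all [List.replicate_succ]
  | succ n ih =>
    cases m with
    | zero => simp [List.replicate_succ] at h
    | succ m =>
      simp only [List.replicate_succ, List.cons_append, List.cons.injEq, true_and] at h
      obtain ⟨h1, h2⟩ := ih h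
      exact ⟨by rw [h1], h2⟩

theorem graphCode_append_injective {n m : ℕ} {G : SimpleGraph (Fin n)} {H : SimpleGraph (Fin m)}
    {s t : List Bool} (h : graphCode G ++ s = graphCode H ++ t) :
    n = m ∧ G ≍ H ∧ s = t := by
  unfold graphCode at h
  simp only [List.append_assoc, List.cons_append] at h
  obtain ⟨rfl, h⟩ := unary_append_injective h
  obtain ⟨h1, h2⟩ := List.append_inj h (by simp [matrixBits])
  refine ⟨rfl, heq_of_eq ?_, h2⟩
  exact SimpleGraph.ext (matrixBits_injective h1)

theorem permCode_injective {n : ℕ} : Function.Injective (@permCode n) := by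
  intro α β h
  have h' := matrixBits_injective h
  ext i
  have := congrFun (congrFun h' i) (α i)
  simp only [eq_iff_iff, true_iff] at this
  rw [this]

/-! ### The two problems -/

/-- `α` is a fixed-edge-free involutory automorphism of `G`: a permutation of order two of the
vertices which preserves adjacency and whose induced action on the edges has no fixed point. -/
def IsFixedEdgeFreeInvolution {n : ℕ} (G : SimpleGraph (Fin n)) (α : Equiv.Perm (Fin n)) : Prop :=
  (∀ u v, G.Adj (α u) (α v) ↔ G.Adj u v) ∧ orderOf α = 2 ∧ ∀ e ∈ G.edgeSet, Sym2.map α e ≠ e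

/-- A pair of arbitrary finite graphs. -/
structure GIInstance : Type where
  n₀ : ℕ
  n₁ : ℕ
  G₀ : SimpleGraph (Fin n₀)
  G₁ : SimpleGraph (Fin n₁)

noncomputable def GIInstance.encode (I : GIInstance) : List Bool :=
  graphCode I.G₀ ++ graphCode I.G₁

theorem GIInstance.encode_injective : Function.Injective GIInstance.encode := by
  rintro ⟨n₀, n₁, G₀, G₁⟩ ⟨m₀, m₁, H₀, H₁⟩ h
  obtain ⟨rfl, h0, h⟩ := graphCode_append_injective h
  obtain ⟨rfl, h1, -⟩ := graphCode_append_injective (s := []) (t := []) (by simpa using h)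
  cases h0
  cases h1
  rfl

open Classical in
/-- Graph Isomorphism: given two graphs, recognize whether they are isomorphic. -/
noncomputable def GI : SearchProblem where
  Inst := GIInstance
  encode := GIInstance.encode
  encode_injective := GIInstance.encode_injective
  IsAnswer I y := y = [decide (Nonempty (I.G₀ ≃g I.G₁))]

/-- Isomorphic graphs `G` and `H` (necessarily with the same number of vertices) together with a
fixed-edge-free involutory automorphism `β` of `H`. -/
structure PARInstance : Type where
  n : ℕ
  G : SimpleGraph (Fin n)
  H : SimpleGraph (Fin n)
  β : Equiv.Perm (Fin n)
  iso : Nonempty (G ≃g H)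
  involution : IsFixedEdgeFreeInvolution H β

noncomputable def PARInstance.encode (I : PARInstance) : List Bool :=
  graphCode I.G ++ (graphCode I.H ++ permCode I.β)

theorem PARInstance.encode_injective : Function.Injective PARInstance.encode := by
  rintro ⟨n, G, H, β, _, _⟩ ⟨n', G', H', β', _, _⟩ h
  obtain ⟨rfl, h0, h⟩ := graphCode_append_injective h
  obtain ⟨-, h1, h⟩ := graphCode_append_injective h
  cases h0
  cases h1
  cases permCode_injective h
  rfl

/-- Permuted Automorphism Reconstruction: find a fixed-edge-free involutory automorphism of `G`. -/
noncomputable def PAR : SearchProblem where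
  Inst := PARInstance
  encode := PARInstance.encode
  encode_injective := PARInstance.encode_injective
  IsAnswer I y := ∃ α : Equiv.Perm (Fin I.n), IsFixedEdgeFreeInvolution I.G α ∧ y = permCode α

/-! Both reductions rest on gadgets that force isomorphisms or involutions to respect a chosen
structure.

From GI to PAR. For graphs `X`, `Y` on `n` vertices, `doubledGraph X Y` puts them side by side
inside a frame: each half has a hub carrying a pendant vertex, and an apex joined to both halves
ensures that these two pendants are the only vertices with at most one neighbour. A fixed-edge-free
involution permutes the pendants and cannot fix one, for then the hub and the edge between them
would be fixed too. Hence it exchanges the hubs and maps `X` isomorphically onto `Y`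
(`exchanges_of_involution`, `adj_iff_of_involution`). The query is `doubledGraph X Y`, `doubledGraph
X X` and the exchange of the two halves of the latter. If `X` and `Y` are isomorphic, this is a
legitimate instance and the answer encodes an isomorphism. If not, the promise fails and the answer
may be anything; therefore the program tests the map that it reads off and accepts only a genuine
isomorphism.

From PAR to GI. An isomorphism `φ` from `G` to `H` turns `β` into the involution `φ⁻¹βφ` of `G`
(`IsFixedEdgeFreeInvolution.conj`), so it suffices to find `φ`. This is the usual search by
individualization: label the vertices of `G` one by one and look each time for a vertex of `H` that
can take the same label while some label-preserving isomorphism remains. Labels are simulated by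
uncoloured graphs: in `labelledGraph` a clique of `n + 1` palette vertices has nested neighbourhoods
in `G`, namely the sublevel sets of the labelling. An isomorphism may permute the palette, but
nested sets are determined by their cardinalities, so the labels are preserved nevertheless
(`eq_of_sublevel_bijection`, `exists_iso_of_labelledGraph_iso`).

Both algorithms are written in a small language whose loops and products are cut off at a bound `B`
linear in the input length. Every command then runs in time polynomial in `B`, with a polynomial
read off from its text (`Cmd.exec_compile`), and `reducible_of_run` leaves only the correctness of
the two programs to prove. -/

/-! ### A structured language on top of the oracle machine

Expressions and commands with counted loops and a single output buffer, which also serves as the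
query tape. All loops are cut off at a bound `B`, so that running time is controlled by the text
of the program alone. -/

namespace StructuredRAM

open OracleRAM

/-- Contents of the registers, the arrays and the output buffer. -/
structure Store : Type where
  reg : ℕ → ℕ
  mem : ℕ → ℕ → ℕ
  buf : List Bool

/-- Expressions without side effects; a nonzero value stands for `true`. -/
inductive Expr : Type
  | const (k : ℕ)
  | reg (r : ℕ)
  /-- the loop bound `B` -/
  | bound
  | add (a b : Expr)
  | sub (a b : Expr)
  | mul (a b : Expr)
  | load (A : ℕ) (i : Expr)
  | cond (c a b : Expr)

namespace Expr

/-- The value of an expression. The first factor of a product is cut off at `B`. -/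
def eval (B : ℕ) (reg : ℕ → ℕ) (mem : ℕ → ℕ → ℕ) : Expr → ℕ
  | const k => k
  | .reg r => reg r
  | bound => B
  | add a b => a.eval B reg mem + b.eval B reg mem
  | sub a b => a.eval B reg mem - b.eval B reg mem
  | mul a b => min (a.eval B reg mem) B * b.eval B reg mem
  | load A i => mem A (i.eval B reg mem)
  | cond c a b => if c.eval B reg mem ≠ 0 then a.eval B reg mem else b.eval B reg mem

/-- Temporary registers have odd numbers; user registers have even numbers. -/
def compile : Expr → ℕ → Prog
  | const k, t => .const (2 * t + 1) k
  | .reg r, t => .seq (.const (2 * t + 1) 0) (.add (2 * t + 1) (2 * r) (2 * t + 1))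
  | bound, t => .seq (.const (2 * t + 1) 0) (.add (2 * t + 1) 1 (2 * t + 1))
  | add a b, t => .seq (a.compile t) (.seq (b.compile (t + 1))
      (.add (2 * t + 1) (2 * t + 1) (2 * (t + 1) + 1)))
  | sub a b, t => .seq (a.compile t) (.seq (b.compile (t + 1))
      (.sub (2 * t + 1) (2 * t + 1) (2 * (t + 1) + 1)))
  | mul a b, t => .seq (a.compile t) (.seq (b.compile (t + 1))
      -- Two truncated subtractions give `x - (x - B) = min x B`, the number of rounds in which the
      -- second factor is added to the accumulator.
      (.seq (.sub (2 * (t + 2) + 1) (2 * t + 1) 1)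
      (.seq (.sub (2 * (t + 3) + 1) (2 * t + 1) (2 * (t + 2) + 1))
      (.seq (.const (2 * t + 1) 0)
      (.seq (.const (2 * (t + 2) + 1) 1)
      (.loop (2 * (t + 3) + 1) (.seq (.add (2 * t + 1) (2 * t + 1) (2 * (t + 1) + 1))
        (.sub (2 * (t + 3) + 1) (2 * (t + 3) + 1) (2 * (t + 2) + 1)))))))))
  | load A i, t => .seq (i.compile t) (.load (2 * t + 1) (2 * A) (2 * t + 1))
  | cond c a b, t => .seq (c.compile t) (.ite (2 * t + 1) (a.compile t) (b.compile t))

/-- A bound for the running time, as a polynomial in `B`. -/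
noncomputable def time : Expr → Polynomial ℕ
  | const _ => 1
  | .reg _ => 2
  | bound => 2
  | add a b => a.time + b.time + 1
  | sub a b => a.time + b.time + 1
  | mul a b => a.time + b.time + (5 + 3 * Polynomial.X)
  | load _ i => i.time + 1
  | cond c a b => c.time + a.time + b.time + 1

end Expr

/-- The machine state `s` represents `σ`, with loop bound `B`. -/
structure Represents (B : ℕ) (σ : Store) (s : State) : Prop where
  reg : ∀ r, s.reg (2 * r) = σ.reg r
  bound : s.reg 1 = B
  length : s.reg 3 = σ.buf.length
  mem : ∀ A, s.mem (2 * A) = σ.mem A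
  buf : ∀ i < σ.buf.length, s.mem 1 i = cells σ.buf i

/-- `s'` differs from `s` at most in the temporary registers from number `t` on. -/
structure SameBelow (t : ℕ) (s s' : State) : Prop where
  mem : s'.mem = s.mem
  reg : ∀ r, r % 2 = 0 ∨ r < 2 * t + 1 → s'.reg r = s.reg r

theorem SameBelow.refl (t : ℕ) (s : State) : SameBelow t s s := ⟨rfl, fun _ _ => rfl⟩

theorem SameBelow.trans {t t' : ℕ} {s s' s'' : State} (h : SameBelow t s s')
    (h' : SameBelow t' s' s'') (ht : t ≤ t') : SameBelow t s s'' :=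
  ⟨h'.mem.trans h.mem, fun r hr => (h'.reg r (by omega)).trans (h.reg r hr)⟩

theorem SameBelow.setReg {t : ℕ} {s s' : State} (h : SameBelow t s s') (u v : ℕ) (hu : t ≤ u) :
    SameBelow t s (s'.setReg (2 * u + 1) v) := by
  refine ⟨h.mem, fun r hr => ?_⟩
  rw [← h.reg r hr]
  simp only [State.setReg]
  rw [Function.update_of_ne (by omega)]

/-- Registers `1` and `3` hold the bound and the buffer length, so temporaries are free to change
only from number `2`, that is register `5`, on. -/
theorem Represents.of_sameBelow {B t : ℕ} {σ : Store} {s s' : State} (h : Represents B σ s)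
    (hs : SameBelow t s s') (ht : 2 ≤ t) : Represents B σ s' where
  reg r := by rw [hs.reg _ (by omega), h.reg]
  bound := by rw [hs.reg _ (by omega), h.bound]
  length := by rw [hs.reg _ (by omega), h.length]
  mem A := by rw [hs.mem, h.mem]
  buf i hi := by rw [hs.mem, h.buf i hi]

/-- In this form the resulting state can be prescribed with a simplified value, which is then
justified by a side goal. -/
theorem exec_add {O : List Bool → List Bool} {s : State} {r a b v : ℕ}
    (h : s.reg a + s.reg b = v) : Exec O (.add r a b) s (s.setReg r v) 1 :=
  h ▸ Exec.add s r a b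

theorem exec_sub {O : List Bool → List Bool} {s : State} {r a b v : ℕ}
    (h : s.reg a - s.reg b = v) : Exec O (.sub r a b) s (s.setReg r v) 1 :=
  h ▸ Exec.sub s r a b

theorem exec_load {O : List Bool → List Bool} {s : State} {r A i v : ℕ}
    (h : s.mem A (s.reg i) = v) : Exec O (.load r A i) s (s.setReg r v) 1 :=
  h ▸ Exec.load s r A i

theorem exec_store {O : List Bool → List Bool} {s : State} {A i r j v : ℕ}
    (hi : s.reg i = j) (hr : s.reg r = v) : Exec O (.store A i r) s (s.setCell A j v) 1 := by
  subst hi hr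
  exact Exec.store s A i r

/-- Each of the `d` rounds costs one test and two instructions; the failing test accounts for the
last step. -/
theorem exec_mul_loop (O : List Bool → List Bool) (t d : ℕ) (s : State)
    (h1 : s.reg (2 * (t + 2) + 1) = 1) (hd : s.reg (2 * (t + 3) + 1) = d) :
    ∃ s', Exec O (.loop (2 * (t + 3) + 1) (.seq (.add (2 * t + 1) (2 * t + 1) (2 * (t + 1) + 1))
        (.sub (2 * (t + 3) + 1) (2 * (t + 3) + 1) (2 * (t + 2) + 1)))) s s' (3 * d + 1) ∧
      SameBelow t s s' ∧
      s'.reg (2 * t + 1) = s.reg (2 * t + 1) + d * s.reg (2 * (t + 1) + 1) := by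
  induction d generalizing s with
  | zero => exact ⟨s, Exec.loop_false hd, SameBelow.refl _ _, by simp⟩
  | succ d ih =>
    obtain ⟨s', he, hs, hv⟩ := ih
      ((s.setReg (2 * t + 1) (s.reg (2 * t + 1) + s.reg (2 * (t + 1) + 1))).setReg
        (2 * (t + 3) + 1) d) (by simp [State.setReg, h1])
        (by simp [State.setReg])
    refine ⟨s', ?_, (((SameBelow.refl t s).setReg t _ le_rfl).setReg (t + 3) _ (by omega)).trans hs
      le_rfl, ?_⟩
    · have hb : Exec O (.seq (.add (2 * t + 1) (2 * t + 1) (2 * (t + 1) + 1))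
          (.sub (2 * (t + 3) + 1) (2 * (t + 3) + 1) (2 * (t + 2) + 1))) s
          ((s.setReg (2 * t + 1) (s.reg (2 * t + 1) + s.reg (2 * (t + 1) + 1))).setReg
            (2 * (t + 3) + 1) d) (1 + 1) := by
        exact Exec.seq (Exec.add s _ _ _) (exec_sub (by simp [State.setReg, h1, hd]))
      have := Exec.loop_true (by omega) hb he
      rwa [show 1 + 1 + (3 * d + 1) + 1 = 3 * (d + 1) + 1 by ring] at this
    · rw [hv]
      simp [State.setReg]
      ring

/-- The code for level `t` touches temporaries from `t` on only. Thus a first operand stored at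
level `t` survives the evaluation of the second one at level `t + 1`. -/
theorem Expr.exec_compile (O : List Bool → List Bool) {B : ℕ} {σ : Store} (e : Expr) (t : ℕ)
    (ht : 2 ≤ t) (s : State) (hs : Represents B σ s) :
    ∃ s' k, Exec O (e.compile t) s s' k ∧ k ≤ e.time.eval B ∧ SameBelow t s s' ∧
      s'.reg (2 * t + 1) = e.eval B σ.reg σ.mem := by
  induction e generalizing t s with
  | const k =>
    exact ⟨_, _, Exec.const _ _ _, by simp [time], (SameBelow.refl t s).setReg t _ le_rfl,
      by simp [State.setReg, eval]⟩
  | reg r =>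
    refine ⟨_, _, Exec.seq (Exec.const _ _ _) (Exec.add _ _ _ _), by simp [time],
      ((SameBelow.refl t s).setReg t _ le_rfl).setReg t _ le_rfl, ?_⟩
    have : 2 * r ≠ 2 * t + 1 := by omega
    simp [State.setReg, eval, this, hs.reg]
  | bound =>
    refine ⟨_, _, Exec.seq (Exec.const _ _ _) (Exec.add _ _ _ _), by simp [time],
      ((SameBelow.refl t s).setReg t _ le_rfl).setReg t _ le_rfl, ?_⟩
    have : 1 ≠ 2 * t + 1 := by omega
    simp only [State.setReg, Function.update_self, eval, add_zero]
    rw [Function.update_of_ne this, hs.bound]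
  | add a b iha ihb =>
    obtain ⟨s₁, k₁, e₁, hk₁, a₁, v₁⟩ := iha t ht s hs
    obtain ⟨s₂, k₂, e₂, hk₂, a₂, v₂⟩ := ihb (t + 1) (by omega) s₁ (hs.of_sameBelow a₁ ht)
    refine ⟨_, _, e₁.seq (e₂.seq (Exec.add _ _ _ _)), ?_,
      (a₁.trans a₂ (by omega)).setReg t _ le_rfl, ?_⟩
    · simp [time]; omega
    · simp only [State.setReg, Function.update_self, eval]
      rw [a₂.reg _ (by omega), v₁, v₂]
  | sub a b iha ihb =>
    obtain ⟨s₁, k₁, e₁, hk₁, a₁, v₁⟩ := iha t ht s hs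
    obtain ⟨s₂, k₂, e₂, hk₂, a₂, v₂⟩ := ihb (t + 1) (by omega) s₁ (hs.of_sameBelow a₁ ht)
    refine ⟨_, _, e₁.seq (e₂.seq (Exec.sub _ _ _ _)), ?_,
      (a₁.trans a₂ (by omega)).setReg t _ le_rfl, ?_⟩
    · simp [time]; omega
    · simp only [State.setReg, Function.update_self, eval]
      rw [a₂.reg _ (by omega), v₁, v₂]
  | mul a b iha ihb =>
    obtain ⟨s₁, k₁, e₁, hk₁, a₁, v₁⟩ := iha t ht s hs
    obtain ⟨s₂, k₂, e₂, hk₂, a₂, v₂⟩ := ihb (t + 1) (by omega) s₁ (hs.of_sameBelow a₁ ht)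
    have hB : s₂.reg 1 = B := by rw [a₂.reg _ (by omega), a₁.reg _ (by omega), hs.bound]
    have hva : s₂.reg (2 * t + 1) = a.eval B σ.reg σ.mem := by rw [a₂.reg _ (by omega), v₁]
    set x := a.eval B σ.reg σ.mem with hx
    have ht0 : t ≠ 0 := by omega
    obtain ⟨s₃, e₃, a₃, v₃⟩ := exec_mul_loop O t (min x B)
      ((((s₂.setReg (2 * (t + 2) + 1) (x - B)).setReg (2 * (t + 3) + 1) (x - (x - B))).setReg
        (2 * t + 1) 0).setReg (2 * (t + 2) + 1) 1)
      (by simp [State.setReg])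
      (by simp [State.setReg]; omega)
    refine ⟨s₃, k₁ + (k₂ + (1 + (1 + (1 + (1 + (3 * min x B + 1)))))), ?_, ?_, ?_, ?_⟩
    · refine e₁.seq (e₂.seq ?_)
      refine Exec.seq (s' := s₂.setReg (2 * (t + 2) + 1) (x - B)) ?_ ?_
      · exact exec_sub (by rw [hva, hB])
      refine Exec.seq
        (s' := (s₂.setReg (2 * (t + 2) + 1) (x - B)).setReg (2 * (t + 3) + 1) (x - (x - B))) ?_ ?_
      · exact exec_sub (by simp [State.setReg, hva])
      exact Exec.seq (Exec.const _ _ _) (Exec.seq (Exec.const _ _ _) e₃)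
    · simp [time]
      have := min_le_right x B
      omega
    · refine SameBelow.trans ?_ a₃ le_rfl
      refine SameBelow.setReg ?_ _ _ (by omega)
      refine SameBelow.setReg ?_ _ _ (by omega)
      refine SameBelow.setReg ?_ _ _ (by omega)
      refine SameBelow.setReg ?_ _ _ (by omega)
      exact a₁.trans a₂ (by omega)
    · rw [v₃]
      simp [State.setReg, eval, ← hx]
      left
      exact v₂
  | load A i ih =>
    obtain ⟨s₁, k₁, e₁, hk₁, a₁, v₁⟩ := ih t ht s hs
    refine ⟨_, _, e₁.seq (Exec.load _ _ _ _), ?_, a₁.setReg t _ le_rfl, ?_⟩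
    · simp [time]; omega
    · simp only [State.setReg, Function.update_self, eval]
      rw [v₁, a₁.mem, hs.mem]
  | cond c a b ihc iha ihb =>
    obtain ⟨s₁, k₁, e₁, hk₁, a₁, v₁⟩ := ihc t ht s hs
    by_cases hc : c.eval B σ.reg σ.mem = 0
    · obtain ⟨s₂, k₂, e₂, hk₂, a₂, v₂⟩ := ihb t ht s₁ (hs.of_sameBelow a₁ ht)
      refine ⟨_, _, e₁.seq (Exec.ite_false (v₁.trans hc) e₂), ?_, a₁.trans a₂ le_rfl, ?_⟩
      · simp [time]; omega
      · simp [eval, hc, v₂]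
    · obtain ⟨s₂, k₂, e₂, hk₂, a₂, v₂⟩ := iha t ht s₁ (hs.of_sameBelow a₁ ht)
      refine ⟨_, _, e₁.seq (Exec.ite_true (by rwa [v₁]) e₂), ?_, a₁.trans a₂ le_rfl, ?_⟩
      · simp [time]; omega
      · simp [eval, hc, v₂]

/-! ### Commands -/

/-- Commands. -/
inductive Cmd : Type
  | skip
  | set (r : ℕ) (e : Expr)
  | store (A : ℕ) (i e : Expr)
  /-- append a bit to the buffer -/
  | push (e : Expr)
  /-- call the oracle on the buffer, which is emptied; the answer is written into array `A` -/
  | ask (A : ℕ)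
  | seq (c d : Cmd)
  | cond (e : Expr) (c d : Cmd)
  /-- run `c` with `reg r` set to `0, 1, …`, for each number below `e` and `B` -/
  | loop (r : ℕ) (e : Expr) (c : Cmd)

/-- `iterate f m σ` applies `f 0`, …, `f (m - 1)` in this order. -/
def iterate (f : ℕ → Store → Store) : ℕ → Store → Store
  | 0, σ => σ
  | m + 1, σ => f m (iterate f m σ)

namespace Store

def setReg (σ : Store) (r v : ℕ) : Store := { σ with reg := Function.update σ.reg r v }

def setArray (σ : Store) (A : ℕ) (f : ℕ → ℕ) : Store :=
  { σ with mem := Function.update σ.mem A f }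

end Store

namespace Cmd

/-- The effect of a command. -/
def run (O : List Bool → List Bool) (B : ℕ) : Cmd → Store → Store
  | skip, σ => σ
  | set r e, σ => σ.setReg r (e.eval B σ.reg σ.mem)
  | store A i e, σ => σ.setArray A
      (Function.update (σ.mem A) (i.eval B σ.reg σ.mem) (e.eval B σ.reg σ.mem))
  | push e, σ => { σ with buf := σ.buf ++ [decide (e.eval B σ.reg σ.mem ≠ 0)] }
  | ask A, σ => { σ.setArray A (cells (O σ.buf)) with buf := [] }
  | seq c d, σ => d.run O B (c.run O B σ)
  | cond e c d, σ => if e.eval B σ.reg σ.mem ≠ 0 then c.run O B σ else d.run O B σ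
  | loop r e c, σ => iterate (fun i τ => c.run O B (τ.setReg r i)) (min (e.eval B σ.reg σ.mem) B) σ

def compile : Cmd → ℕ → Prog
  | skip, t => .const (2 * t + 1) 0
  | set r e, t => .seq (e.compile t) (.seq (.const (2 * (t + 1) + 1) 0)
      (.add (2 * r) (2 * t + 1) (2 * (t + 1) + 1)))
  | store A i e, t => .seq (i.compile t) (.seq (e.compile (t + 1))
      (.store (2 * A) (2 * t + 1) (2 * (t + 1) + 1)))
  | push e, t => .seq (e.compile t) (.seq
      (.ite (2 * t + 1) (.const (2 * t + 1) 2) (.const (2 * t + 1) 1))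
      (.seq (.store 1 3 (2 * t + 1)) (.seq (.const (2 * t + 1) 1) (.add 3 3 (2 * t + 1)))))
  -- Cells behind the end of the buffer may contain symbols of an earlier query, so the terminating
  -- blank has to be written explicitly.
  | ask A, t => .seq (.const (2 * t + 1) 0) (.seq (.store 1 3 (2 * t + 1))
      (.seq (.query 1 (2 * A)) (.const 3 0)))
  | seq c d, t => .seq (c.compile t) (d.compile t)
  | cond e c d, t => .seq (e.compile t) (.ite (2 * t + 1) (c.compile t) (d.compile t))
  -- Temporary `t` counts the remaining rounds down and `t + 1` counts the index up. The index is
  -- copied to the user register in each round, so the body may overwrite that register.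
  | loop r e c, t => .seq (e.compile t) (.seq (.sub (2 * (t + 1) + 1) (2 * t + 1) 1)
      (.seq (.sub (2 * t + 1) (2 * t + 1) (2 * (t + 1) + 1))
      (.seq (.const (2 * (t + 1) + 1) 0)
      (.loop (2 * t + 1) (.seq (.const (2 * (t + 2) + 1) 0)
        (.seq (.add (2 * r) (2 * (t + 1) + 1) (2 * (t + 2) + 1))
        (.seq (c.compile (t + 2)) (.seq (.const (2 * (t + 2) + 1) 1)
        (.seq (.add (2 * (t + 1) + 1) (2 * (t + 1) + 1) (2 * (t + 2) + 1))
        (.sub (2 * t + 1) (2 * t + 1) (2 * (t + 2) + 1)))))))))))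

/-- An amortized bound for the running time, as a polynomial in `B`: the symbols of a query are
paid for when they are pushed. -/
noncomputable def time : Cmd → Polynomial ℕ
  | skip => 1
  | set _ e => e.time + 2
  | store _ i e => i.time + e.time + 1
  | push e => e.time + 6
  | ask _ => 4
  | seq c d => c.time + d.time
  | cond e c d => e.time + c.time + d.time + 1
  | loop _ e c => e.time + 4 + Polynomial.X * (c.time + 6)

end Cmd

theorem Represents.setReg {B : ℕ} {σ : Store} {s : State} (h : Represents B σ s) (r v : ℕ) :
    Represents B (σ.setReg r v) (s.setReg (2 * r) v) where
  reg r' := by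
    by_cases hr : r' = r
    · simp [State.setReg, Store.setReg, hr]
    · simp [State.setReg, Store.setReg, hr, h.reg]
  bound := by
    have : 1 ≠ 2 * r := by omega
    simp [State.setReg, this, h.bound]
  length := by
    have : 3 ≠ 2 * r := by omega
    simp [State.setReg, this, h.length, Store.setReg]
  mem A := h.mem A
  buf i hi := h.buf i hi

theorem Represents.setArray {B : ℕ} {σ : Store} {s : State} (h : Represents B σ s) (A : ℕ)
    (f : ℕ → ℕ) : Represents B (σ.setArray A f) (s.setArray (2 * A) f) where
  reg r' := h.reg r'
  bound := h.bound
  length := h.length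
  mem A' := by
    by_cases hr : A' = A
    · simp [State.setArray, Store.setArray, hr]
    · simp [State.setArray, Store.setArray, hr, h.mem]
  buf i hi := by
    have : 1 ≠ 2 * A := by omega
    simpa [State.setArray, Store.setArray, this] using h.buf i hi

/-- The temporary registers with numbers in `[2, t)` are unchanged. -/
def KeepsTemps (t : ℕ) (s s' : State) : Prop :=
  ∀ u, 2 ≤ u → u < t → s'.reg (2 * u + 1) = s.reg (2 * u + 1)

theorem KeepsTemps.trans {t t' : ℕ} {s s' s'' : State} (h : KeepsTemps t s s')
    (h' : KeepsTemps t' s' s'') (ht : t ≤ t') : KeepsTemps t s s'' :=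
  fun u h2 hu => (h' u h2 (by omega)).trans (h u h2 hu)

theorem SameBelow.keepsTemps {t : ℕ} {s s' : State} (h : SameBelow t s s') : KeepsTemps t s s' :=
  fun u _ hu => h.reg _ (by omega)

theorem cells_append_of_lt {w w' : List Bool} {i : ℕ} (hi : i < w.length) :
    cells (w ++ w') i = cells w i := by
  simp [cells, List.getElem?_append_left hi]

theorem cells_append_add (w w' : List Bool) (i : ℕ) :
    cells (w ++ w') (w.length + i) = cells w' i := by
  simp [cells, List.getElem?_append_right]

theorem cells_length (w : List Bool) : cells w w.length = 0 := by
  simp [cells]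

/-- Induction on the number `d` of remaining rounds. The body is compiled at level `t + 2`, so both
counters survive it. A round costs the body, five instructions and one test, whence the summand `6`.
-/
theorem Cmd.exec_loop (O : List Bool → List Bool) {B : ℕ} (r : ℕ) (c : Cmd) (t : ℕ)
    (ht : 2 ≤ t)
    (ih : ∀ u, 2 ≤ u → ∀ (σ : Store) (s : State), Represents B σ s → ∃ s' k,
      Exec O (c.compile u) s s' k ∧ Represents B (c.run O B σ) s' ∧ KeepsTemps u s s' ∧
      k + (c.run O B σ).buf.length ≤ c.time.eval B + σ.buf.length) (σ : Store) (m d i : ℕ)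
    (hm : i + d = m) (s : State)
    (hs : Represents B (iterate (fun i τ => c.run O B (τ.setReg r i)) i σ) s)
    (hd : s.reg (2 * t + 1) = d) (hi : s.reg (2 * (t + 1) + 1) = i) :
    ∃ s' k, Exec O (.loop (2 * t + 1) (.seq (.const (2 * (t + 2) + 1) 0)
        (.seq (.add (2 * r) (2 * (t + 1) + 1) (2 * (t + 2) + 1))
        (.seq (c.compile (t + 2)) (.seq (.const (2 * (t + 2) + 1) 1)
        (.seq (.add (2 * (t + 1) + 1) (2 * (t + 1) + 1) (2 * (t + 2) + 1))
        (.sub (2 * t + 1) (2 * t + 1) (2 * (t + 2) + 1)))))))) s s' k ∧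
      Represents B (iterate (fun i τ => c.run O B (τ.setReg r i)) m σ) s' ∧ KeepsTemps t s s' ∧
      k + (iterate (fun i τ => c.run O B (τ.setReg r i)) m σ).buf.length ≤
        1 + d * (c.time.eval B + 6) +
          (iterate (fun i τ => c.run O B (τ.setReg r i)) i σ).buf.length := by
  induction d generalizing i s with
  | zero =>
    obtain rfl : i = m := by omega
    exact ⟨s, 1, Exec.loop_false hd, hs, fun _ _ _ => rfl, by simp⟩
  | succ d ihd =>
    set σi := iterate (fun i τ => c.run O B (τ.setReg r i)) i σ with hσi
    have hstep : iterate (fun i τ => c.run O B (τ.setReg r i)) (i + 1) σ =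
        c.run O B (σi.setReg r i) := rfl
    have hr0 : SameBelow (t + 2) s (s.setReg (2 * (t + 2) + 1) 0) :=
      (SameBelow.refl _ _).setReg _ _ le_rfl
    have hs1 : Represents B (σi.setReg r i) ((s.setReg (2 * (t + 2) + 1) 0).setReg (2 * r) i) :=
      (hs.of_sameBelow hr0 (by omega)).setReg r i
    obtain ⟨s₂, k₂, e₂, hs₂, kt₂, hk₂⟩ := ih (t + 2) (by omega) _ _ hs1
    have odd_ne : ∀ u, 2 * u + 1 ≠ 2 * r := fun u => by omega
    have vt : s₂.reg (2 * t + 1) = d + 1 := by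
      rw [kt₂ t ht (by omega)]
      simp [State.setReg, odd_ne, hd]
    have vi : s₂.reg (2 * (t + 1) + 1) = i := by
      rw [kt₂ (t + 1) (by omega) (by omega)]
      simp [State.setReg, odd_ne, hi]
    have hsame : SameBelow t s₂ (((s₂.setReg (2 * (t + 2) + 1) 1).setReg (2 * (t + 1) + 1)
        (i + 1)).setReg (2 * t + 1) d) :=
      (((SameBelow.refl t s₂).setReg (t + 2) _ (by omega)).setReg (t + 1) _ (by omega)).setReg t _
        le_rfl
    obtain ⟨s₃, k₃, e₃, hs₃, kt₃, hk₃⟩ := ihd (i + 1) (by omega)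
      (((s₂.setReg (2 * (t + 2) + 1) 1).setReg (2 * (t + 1) + 1) (i + 1)).setReg (2 * t + 1) d)
      (by rw [hstep]; exact hs₂.of_sameBelow hsame ht)
      (by simp [State.setReg]) (by simp [State.setReg])
    refine ⟨s₃, _, Exec.loop_true (by omega) (Exec.seq (Exec.const _ _ _)
      (Exec.seq (exec_add (by simp [State.setReg, hi])) (Exec.seq e₂ (Exec.seq (Exec.const _ _ _)
        (Exec.seq (exec_add (by simp [State.setReg, vi]))
          (exec_sub (by simp [State.setReg, vt]))))))) e₃, hs₃, ?_, ?_⟩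
    · refine KeepsTemps.trans ?_ kt₃ le_rfl
      refine KeepsTemps.trans ?_ hsame.keepsTemps le_rfl
      refine KeepsTemps.trans ?_ kt₂ (by omega)
      intro u _ hu
      have h3 : u ≠ t + 2 := by omega
      simp [State.setReg, odd_ne, h3]
    · rw [hstep] at hk₃
      have : (σi.setReg r i).buf = σi.buf := rfl
      rw [this] at hk₂
      have hmul : (d + 1) * (c.time.eval B + 6) = d * (c.time.eval B + 6) + (c.time.eval B + 6) := by
        ring
      omega

/-- The buffer length acts as a potential. A push takes five steps beyond its expression and raises
the potential by one; a query takes as many steps as the buffer has symbols, plus four, and resets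
the potential to zero. User registers change here, so only the preservation of lower temporaries is
carried along, which is what an enclosing loop needs. -/
theorem Cmd.exec_compile (O : List Bool → List Bool) {B : ℕ} (c : Cmd) (t : ℕ) (ht : 2 ≤ t)
    (σ : Store) (s : State) (hs : Represents B σ s) :
    ∃ s' k, Exec O (c.compile t) s s' k ∧ Represents B (c.run O B σ) s' ∧ KeepsTemps t s s' ∧
      k + (c.run O B σ).buf.length ≤ c.time.eval B + σ.buf.length := by
  induction c generalizing t σ s with
  | skip =>
    have h := (SameBelow.refl t s).setReg t 0 le_rfl
    exact ⟨_, _, Exec.const _ _ _, hs.of_sameBelow h ht, h.keepsTemps, by simp [time, run]⟩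
  | set r e =>
    obtain ⟨s₁, k₁, e₁, hk₁, a₁, v₁⟩ := e.exec_compile O t ht s hs
    have a₂ := a₁.setReg (t + 1) 0 (by omega)
    refine ⟨(s₁.setReg (2 * (t + 1) + 1) 0).setReg (2 * r) (e.eval B σ.reg σ.mem), k₁ + (1 + 1),
      e₁.seq (Exec.seq (Exec.const _ _ _) (exec_add (by simp [State.setReg, v₁]))),
      (hs.of_sameBelow a₂ ht).setReg r _, ?_, ?_⟩
    · refine a₂.keepsTemps.trans (t' := t) ?_ le_rfl
      intro u _ _
      have : 2 * u + 1 ≠ 2 * r := by omega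
      simp [State.setReg, this]
    · simp [time, run, Store.setReg]; omega
  | store A i e =>
    obtain ⟨s₁, k₁, e₁, hk₁, a₁, v₁⟩ := i.exec_compile O t ht s hs
    obtain ⟨s₂, k₂, e₂, hk₂, a₂, v₂⟩ :=
      e.exec_compile O (t + 1) (by omega) s₁ (hs.of_sameBelow a₁ ht)
    have a₃ := a₁.trans a₂ (by omega)
    refine ⟨s₂.setArray (2 * A) (Function.update (σ.mem A) (i.eval B σ.reg σ.mem)
      (e.eval B σ.reg σ.mem)), k₁ + (k₂ + 1), e₁.seq (e₂.seq ?_),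
      (hs.of_sameBelow a₃ ht).setArray A _, a₃.keepsTemps, ?_⟩
    · convert Exec.store (O := O) _ _ _ _ using 1
      rw [State.setCell, v₂, a₂.reg _ (by omega), v₁, a₃.mem, hs.mem]
    · simp [time, run, Store.setArray]; omega
  | push e =>
    obtain ⟨s₁, k₁, e₁, hk₁, a₁, v₁⟩ := e.exec_compile O t ht s hs
    set b := decide (e.eval B σ.reg σ.mem ≠ 0) with hb
    have e₂ : Exec O (.ite (2 * t + 1) (.const (2 * t + 1) 2) (.const (2 * t + 1) 1)) s₁
        (s₁.setReg (2 * t + 1) (cells [b] 0)) (1 + 1) := by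
      by_cases h : e.eval B σ.reg σ.mem = 0
      · convert Exec.ite_false (v₁.trans h) (Exec.const _ _ _) using 2
        simp [hb, h, cells]
      · convert Exec.ite_true (by rwa [v₁]) (Exec.const _ _ _) using 2
        simp [hb, h, cells]
    set s₂ := s₁.setReg (2 * t + 1) (cells [b] 0) with hs₂
    have a₂ : SameBelow t s s₂ := a₁.setReg t _ le_rfl
    have r₂ : Represents B σ s₂ := hs.of_sameBelow a₂ ht
    have v₂ : s₂.reg (2 * t + 1) = cells [b] 0 := by simp [hs₂, State.setReg]
    have ht3 : 3 ≠ 2 * t + 1 := by omega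
    refine ⟨(((s₂.setCell 1 σ.buf.length (cells [b] 0)).setReg (2 * t + 1) 1).setReg 3
      (σ.buf.length + 1)), k₁ + (1 + 1 + (1 + (1 + 1))),
      e₁.seq (Exec.seq e₂ (Exec.seq (exec_store r₂.length v₂) (Exec.seq (Exec.const _ _ _)
        (exec_add (by simp [State.setReg, State.setCell, State.setArray, ht3, r₂.length]))))),
      ?_, ?_, ?_⟩
    · constructor
      · intro r
        have h1 : 2 * r ≠ 3 := by omega
        have h2 : 2 * r ≠ 2 * t + 1 := by omega
        simpa [run, State.setReg, State.setCell, State.setArray, h1, h2] using r₂.reg r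
      · have h2 : 1 ≠ 2 * t + 1 := by omega
        rw [← r₂.bound]
        simp only [State.setReg, State.setCell, State.setArray]
        rw [Function.update_of_ne (by decide), Function.update_of_ne h2]
      · simp [State.setReg, run]
      · intro A
        have h1 : 2 * A ≠ 1 := by omega
        simpa [run, State.setReg, State.setCell, State.setArray, h1] using r₂.mem A
      · intro i hi
        simp only [run, List.length_append, List.length_singleton] at hi
        rcases Nat.lt_succ_iff_lt_or_eq.mp hi with h | rfl
        · have h1 := r₂.buf i h
          have h2 : i ≠ σ.buf.length := by omega
          simp [State.setReg, State.setCell, State.setArray, h2, h1, run, cells_append_of_lt h]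
        · have := cells_append_add σ.buf [b] 0
          simp only [add_zero] at this
          simp only [run, ← hb, this]
          simp [State.setReg, State.setCell, State.setArray]
    · intro u h2 hu
      have h1 : u ≠ 1 := by omega
      have h3 : u ≠ t := by omega
      simpa [State.setReg, State.setCell, State.setArray, h1, h3] using a₂.reg _ (by omega)
    · simp [time, run]; omega
  | ask A =>
    have a₁ : SameBelow t s (s.setReg (2 * t + 1) 0) := (SameBelow.refl _ _).setReg _ _ le_rfl
    have r₁ := hs.of_sameBelow a₁ ht
    set s₁ := s.setReg (2 * t + 1) 0
    set s₂ := s₁.setCell 1 σ.buf.length 0 with hs₂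
    have hq : Holds (s₂.mem 1) σ.buf := by
      intro i hi
      rcases Nat.lt_or_eq_of_le hi with h | rfl
      · have h2 : i ≠ σ.buf.length := by omega
        simpa [hs₂, State.setCell, State.setArray, h2] using r₁.buf i h
      · simp [hs₂, State.setCell, State.setArray, cells_length]
    refine ⟨(s₂.setArray (2 * A) (cells (O σ.buf))).setReg 3 0, _,
      Exec.seq (Exec.const _ _ _) (Exec.seq (exec_store r₁.length (by simp [State.setReg]))
        (Exec.seq (Exec.query _ _ _ _ hq) (Exec.const _ _ _))), ?_, ?_, ?_⟩
    · constructor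
      · intro r
        have h1 : 2 * r ≠ 3 := by omega
        simpa [run, Store.setArray, hs₂, State.setReg, State.setCell, State.setArray, h1]
          using r₁.reg r
      · simpa [hs₂, State.setReg, State.setCell, State.setArray] using r₁.bound
      · simp [State.setReg, run]
      · intro A'
        have h1 : 2 * A' ≠ 1 := by omega
        by_cases h : A' = A
        · simp [State.setReg, State.setArray, run, Store.setArray, h]
        · simpa [hs₂, State.setReg, State.setCell, State.setArray, h1, h, run, Store.setArray]
            using r₁.mem A'
      · simp [run]
    · intro u h2 hu
      have h1 : u ≠ 1 := by omega
      simpa [hs₂, State.setReg, State.setCell, State.setArray, h1] using a₁.reg _ (by omega)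
    · simp [time, run]; omega
  | seq c d ihc ihd =>
    obtain ⟨s₁, k₁, e₁, r₁, kt₁, hk₁⟩ := ihc t ht σ s hs
    obtain ⟨s₂, k₂, e₂, r₂, kt₂, hk₂⟩ := ihd t ht _ s₁ r₁
    exact ⟨s₂, _, e₁.seq e₂, r₂, kt₁.trans kt₂ le_rfl, by simp [time, run]; omega⟩
  | cond e c d ihc ihd =>
    obtain ⟨s₁, k₁, e₁, hk₁, a₁, v₁⟩ := e.exec_compile O t ht s hs
    have r₁ := hs.of_sameBelow a₁ ht
    by_cases h : e.eval B σ.reg σ.mem = 0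
    · obtain ⟨s₂, k₂, e₂, r₂, kt₂, hk₂⟩ := ihd t ht _ s₁ r₁
      refine ⟨s₂, _, e₁.seq (Exec.ite_false (v₁.trans h) e₂), by simpa [run, h] using r₂,
        a₁.keepsTemps.trans kt₂ le_rfl, ?_⟩
      simp [time, run, h]; omega
    · obtain ⟨s₂, k₂, e₂, r₂, kt₂, hk₂⟩ := ihc t ht _ s₁ r₁
      refine ⟨s₂, _, e₁.seq (Exec.ite_true (by rwa [v₁]) e₂), by simpa [run, h] using r₂,
        a₁.keepsTemps.trans kt₂ le_rfl, ?_⟩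
      simp [time, run, h]; omega
  | loop r e c ih =>
    obtain ⟨s₁, k₁, e₁, hk₁, a₁, v₁⟩ := e.exec_compile O t ht s hs
    set x := e.eval B σ.reg σ.mem with hx
    have hB : s₁.reg 1 = B := by rw [a₁.reg _ (by omega), hs.bound]
    set s₂ := ((s₁.setReg (2 * (t + 1) + 1) (x - B)).setReg (2 * t + 1) (min x B)).setReg
      (2 * (t + 1) + 1) 0 with hs₂
    have a₂ : SameBelow t s s₂ :=
      ((a₁.setReg (t + 1) _ (by omega)).setReg t _ le_rfl).setReg (t + 1) _ (by omega)
    obtain ⟨s₃, k₃, e₃, r₃, kt₃, hk₃⟩ := Cmd.exec_loop O r c t ht (fun u hu σ s h => ih u hu σ s h)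
      σ (min x B) (min x B) 0 (by omega) s₂ (hs.of_sameBelow a₂ ht)
      (by simp [hs₂, State.setReg]) (by simp [hs₂, State.setReg])
    refine ⟨s₃, k₁ + (1 + (1 + (1 + k₃))), e₁.seq (Exec.seq (exec_sub (by rw [v₁, hB]))
      (Exec.seq ?_ (Exec.seq (Exec.const _ _ _) e₃))), r₃, a₂.keepsTemps.trans kt₃ le_rfl, ?_⟩
    · refine exec_sub ?_
      simp [State.setReg, v₁]
      omega
    · have hle : min x B * (c.time.eval B + 6) ≤ B * (c.time.eval B + 6) :=
        Nat.mul_le_mul_right _ (min_le_right x B)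
      simp only [run, time, Polynomial.eval_add, Polynomial.eval_mul, Polynomial.eval_X,
        Polynomial.eval_ofNat, ← hx]
      have : iterate (fun i τ => c.run O B (τ.setReg r i)) 0 σ = σ := rfl
      rw [this] at hk₃
      omega

/-! ### Complete programs -/

/-- The store in which a program with input `x` is started. -/
def initStore (x : List Bool) : Store := ⟨fun _ => 0, Function.update (fun _ _ => 0) 0 (cells x), []⟩

/-- Put the length of the input plus `8` into the bound register. -/
def measureInput : Prog :=
  .seq (.const 5 1) (.seq (.load 7 0 1) (.seq
    -- The summand `8` makes the bound large enough for the queried graphs, which have `2n + 5` or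
    -- `2n + 3` vertices, even when `n` is tiny.
    (.loop 7 (.seq (.add 1 1 5) (.load 7 0 1))) (.seq (.const 5 8) (.seq (.add 1 1 5)
    (.seq (.const 5 0) (.const 7 0))))))

theorem cells_ne_zero_of_lt {w : List Bool} {i : ℕ} (hi : i < w.length) : cells w i ≠ 0 := by
  unfold cells
  rw [List.getElem?_eq_getElem hi]
  cases w[i] <;> simp

theorem exec_measure_loop (O : List Bool → List Bool) (x : List Bool) (d i : ℕ)
    (h : i + d = x.length) (s : State) (hm : s.mem 0 = cells x) (h1 : s.reg 1 = i)
    (h5 : s.reg 5 = 1) (h7 : s.reg 7 = cells x i) :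
    ∃ s', Exec O (.loop 7 (.seq (.add 1 1 5) (.load 7 0 1))) s s' (3 * d + 1) ∧ s'.mem = s.mem ∧
      s'.reg 1 = x.length ∧ ∀ r, r ≠ 1 → r ≠ 7 → s'.reg r = s.reg r := by
  induction d generalizing i s with
  | zero =>
    obtain rfl : i = x.length := by omega
    exact ⟨s, Exec.loop_false (by rw [h7, cells_length]), rfl, h1, fun _ _ _ => rfl⟩
  | succ d ih =>
    obtain ⟨s', e, m', v', f'⟩ := ih (i + 1) (by omega)
      ((s.setReg 1 (i + 1)).setReg 7 (cells x (i + 1))) (by simpa [State.setReg] using hm)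
      (by simp [State.setReg]) (by simp [State.setReg, h5]) (by simp [State.setReg])
    refine ⟨s', ?_, by simpa [State.setReg] using m', v', fun r hr1 hr7 => ?_⟩
    · have hb : Exec O (.seq (.add 1 1 5) (.load 7 0 1)) s
          ((s.setReg 1 (i + 1)).setReg 7 (cells x (i + 1))) (1 + 1) := by
        exact Exec.seq (exec_add (by rw [h1, h5])) (exec_load (by simp [State.setReg, hm]))
      have := Exec.loop_true (by rw [h7]; exact cells_ne_zero_of_lt (by omega)) hb e
      rwa [show 1 + 1 + (3 * d + 1) + 1 = 3 * (d + 1) + 1 by ring] at this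
    · rw [f' r hr1 hr7]
      simp [State.setReg, hr1, hr7]

theorem exec_measureInput (O : List Bool → List Bool) (x : List Bool) :
    ∃ s, Exec O measureInput (initState x) s (3 * x.length + 7) ∧
      Represents (x.length + 8) (initStore x) s := by
  obtain ⟨s, e, hm, h1, hr⟩ := exec_measure_loop O x x.length 0 (by omega)
    (((initState x).setReg 5 1).setReg 7 (cells x 0))
    (by simp [State.setReg, initState, State.setArray])
    (by simp [State.setReg, initState, State.setArray]) (by simp [State.setReg])
    (by simp [State.setReg])
  have hreg : ∀ r, r ≠ 1 → r ≠ 5 → r ≠ 7 → s.reg r = 0 := by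
    intro r h1 h5 h7
    rw [hr r h1 h7]
    simp [State.setReg, initState, State.setArray, h5, h7]
  refine ⟨((((s.setReg 5 8).setReg 1 (x.length + 8)).setReg 5 0).setReg 7 0), ?_, ?_⟩
  · have hl : Exec O (.load 7 0 1) ((initState x).setReg 5 1)
        (((initState x).setReg 5 1).setReg 7 (cells x 0)) 1 :=
      exec_load (by simp [State.setReg, initState, State.setArray])
    have ha : Exec O (.add 1 1 5) (s.setReg 5 8) ((s.setReg 5 8).setReg 1 (x.length + 8)) 1 :=
      exec_add (by simp [State.setReg, h1])
    have := Exec.seq (Exec.const (O := O) (initState x) 5 1) (hl.seq (e.seq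
      (Exec.seq (Exec.const _ 5 8) (ha.seq (Exec.seq (Exec.const _ 5 0) (Exec.const _ 7 0))))))
    rwa [show 1 + (1 + (3 * x.length + 1 + (1 + (1 + (1 + 1))))) = 3 * x.length + 7 by ring] at this
  · constructor
    · intro r
      have h7 : 2 * r ≠ 7 := by omega
      have h5 : 2 * r ≠ 5 := by omega
      have h1 : 2 * r ≠ 1 := by omega
      simp [State.setReg, initStore, h7, h5, h1, hreg]
    · simp [State.setReg]
    · simp [State.setReg, initStore, hreg]
    · intro A
      simp only [State.setReg, hm, initState, State.setArray, initStore]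
      by_cases h : A = 0
      · simp [h]
      · simp [h]
    · simp [initStore]

/-- Close the output string by a blank. -/
def finish : Prog := .seq (.const 5 0) (.store 1 3 5)

/-- It suffices to give a program in the structured language. -/
theorem reducible_of_run {P Q : SearchProblem} (c : Cmd)
    (h : ∀ O, Q.SolvedBy O → ∀ I : P.Inst,
      P.IsAnswer I (c.run O ((P.encode I).length + 8) (initStore (P.encode I))).buf) :
    PolyTimeTuringReducible P Q := by
  refine ⟨.seq measureInput (.seq (c.compile 2) finish),
    -- Measuring the input takes `3 * |x| + 7` steps and closing the output takes `2`; in between,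
    -- the bound is `|x| + 8`.
    3 * Polynomial.X + 9 + c.time.comp (Polynomial.X + 8), fun O hO I => ⟨_, h O hO I, ?_⟩⟩
  set x := P.encode I
  obtain ⟨s₁, e₁, r₁⟩ := exec_measureInput O x
  obtain ⟨s₂, k₂, e₂, r₂, -, hk₂⟩ := c.exec_compile O 2 le_rfl _ s₁ r₁
  refine ⟨_, _, e₁.seq (e₂.seq (Exec.seq (Exec.const _ _ _) (Exec.store _ _ _ _))), ?_, ?_⟩
  · simp [initStore] at hk₂ ⊢
    omega
  · intro i hi
    have hl := r₂.length
    rcases Nat.lt_or_eq_of_le hi with h | rfl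
    · have h2 : i ≠ (c.run O (x.length + 8) (initStore x)).buf.length := by omega
      simpa [State.setCell, State.setArray, State.setReg, hl, h2] using r₂.buf i h
    · simp [State.setCell, State.setArray, State.setReg, hl, cells_length]

end StructuredRAM

namespace StructuredRAM

open OracleRAM

/-! ### Reasoning about commands -/

theorem iterate_induction {f : ℕ → Store → Store} {m : ℕ} {σ : Store} (P : ℕ → Store → Prop)
    (h0 : P 0 σ) (hs : ∀ i < m, ∀ τ, P i τ → P (i + 1) (f i τ)) : P m (iterate f m σ) := by
  induction m with
  | zero => exact h0
  | succ m ih => exact hs m (by omega) _ (ih fun i hi => hs i (by omega))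

/-- Invariants are indexed by the number of completed rounds. The assumption `m ≤ B` says that the
cut-off does not interfere. -/
theorem Cmd.run_loop_induction {O : List Bool → List Bool} {B r m : ℕ} {e : Expr} {c : Cmd}
    {σ : Store} (P : ℕ → Store → Prop) (he : e.eval B σ.reg σ.mem = m) (hm : m ≤ B) (h0 : P 0 σ)
    (hs : ∀ i < m, ∀ τ, P i τ → P (i + 1) (c.run O B (τ.setReg r i))) :
    P m ((Cmd.loop r e c).run O B σ) := by
  have : (Cmd.loop r e c).run O B σ = iterate (fun i τ => c.run O B (τ.setReg r i)) m σ := by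
    simp [Cmd.run, he, hm]
  rw [this]
  exact iterate_induction P h0 hs

/-! ### Boolean operations and comparisons through truncated subtraction -/

namespace Expr

/-- All tests rest on the fact that `a - b` vanishes exactly if `a ≤ b`; in particular `1 - a` is
nonzero exactly if `a = 0`. -/
def not (a : Expr) : Expr := sub (const 1) a
def le (a b : Expr) : Expr := not (sub a b)
def lt (a b : Expr) : Expr := sub b a
def eq (a b : Expr) : Expr := not (add (sub a b) (sub b a))
def and (a b : Expr) : Expr := cond a b (const 0)
def or (a b : Expr) : Expr := cond a (const 1) b

variable {B : ℕ} {reg : ℕ → ℕ} {mem : ℕ → ℕ → ℕ} {a b : Expr}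

@[simp] theorem eval_const (k : ℕ) : (const k).eval B reg mem = k := rfl

@[simp] theorem eval_reg (r : ℕ) : (Expr.reg r).eval B reg mem = reg r := rfl

@[simp] theorem eval_bound : bound.eval B reg mem = B := rfl

@[simp] theorem eval_add : (add a b).eval B reg mem = a.eval B reg mem + b.eval B reg mem := rfl

@[simp] theorem eval_sub : (sub a b).eval B reg mem = a.eval B reg mem - b.eval B reg mem := rfl

@[simp] theorem eval_mul :
    (mul a b).eval B reg mem = min (a.eval B reg mem) B * b.eval B reg mem := rfl

@[simp] theorem eval_load (A : ℕ) : (load A a).eval B reg mem = mem A (a.eval B reg mem) := rfl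

/-- The expression is true. -/
def IsTrue (B : ℕ) (reg : ℕ → ℕ) (mem : ℕ → ℕ → ℕ) (a : Expr) : Prop := a.eval B reg mem ≠ 0

@[simp] theorem isTrue_not : (not a).IsTrue B reg mem ↔ ¬ a.IsTrue B reg mem := by
  simp [IsTrue, not]; omega

@[simp] theorem isTrue_le :
    (le a b).IsTrue B reg mem ↔ a.eval B reg mem ≤ b.eval B reg mem := by
  simp [IsTrue, le, not]; omega

@[simp] theorem isTrue_lt :
    (lt a b).IsTrue B reg mem ↔ a.eval B reg mem < b.eval B reg mem := by
  simp [IsTrue, lt]; omega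

@[simp] theorem isTrue_eq :
    (eq a b).IsTrue B reg mem ↔ a.eval B reg mem = b.eval B reg mem := by
  simp [IsTrue, eq, not]; omega

@[simp] theorem isTrue_and :
    (and a b).IsTrue B reg mem ↔ a.IsTrue B reg mem ∧ b.IsTrue B reg mem := by
  by_cases h : a.eval B reg mem = 0 <;> simp [IsTrue, and, eval, h]

@[simp] theorem isTrue_or :
    (or a b).IsTrue B reg mem ↔ a.IsTrue B reg mem ∨ b.IsTrue B reg mem := by
  by_cases h : a.eval B reg mem = 0 <;> simp [IsTrue, or, eval, h]

end Expr

theorem Cmd.run_seq (O : List Bool → List Bool) (B : ℕ) (c d : Cmd) (σ : Store) :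
    (Cmd.seq c d).run O B σ = d.run O B (c.run O B σ) := rfl

open Classical in
theorem Cmd.run_cond (O : List Bool → List Bool) (B : ℕ) (e : Expr) (c d : Cmd) (σ : Store) :
    (Cmd.cond e c d).run O B σ =
      if e.IsTrue B σ.reg σ.mem then c.run O B σ else d.run O B σ := by
  by_cases h : e.eval B σ.reg σ.mem = 0 <;> simp [Cmd.run, Expr.IsTrue, h]

open Classical in
theorem Cmd.run_push (O : List Bool → List Bool) (B : ℕ) (e : Expr) (σ : Store) :
    (Cmd.push e).run O B σ = { σ with buf := σ.buf ++ [decide (e.IsTrue B σ.reg σ.mem)] } := by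
  by_cases h : e.eval B σ.reg σ.mem = 0 <;> simp [Cmd.run, Expr.IsTrue, h]

/-! ### Writing and reading matrices and graphs -/

open Classical in
theorem matrixBits_getElem? {n : ℕ} (R : Fin n → Fin n → Prop) (i j : Fin n) :
    (matrixBits R)[i.val * n + j.val]? = some (decide (R i j)) := by
  have hk : i.val * n + j.val < n * n := by
    calc i.val * n + j.val < i.val * n + n := by omega
      _ = (i.val + 1) * n := by ring
      _ ≤ n * n := Nat.mul_le_mul_right _ (by omega)
  have hn : 0 < n := by omega
  have h1 : (⟨i.val * n + j.val, hk⟩ : Fin (n * n)).divNat = i := by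
    ext
    simp only [Fin.coe_divNat]
    rw [mul_comm, Nat.mul_add_div hn, Nat.div_eq_of_lt j.isLt, add_zero]
  have h2 : (⟨i.val * n + j.val, hk⟩ : Fin (n * n)).modNat = j := by
    ext
    simp only [Fin.coe_modNat]
    rw [mul_comm, Nat.mul_add_mod, Nat.mod_eq_of_lt j.isLt]
  unfold matrixBits
  rw [List.getElem?_ofFn, dif_pos hk]
  simp [h1, h2]

theorem matrixBits_length {n : ℕ} (R : Fin n → Fin n → Prop) :
    (matrixBits R).length = n * n := by
  simp [matrixBits]

theorem cells_matrixBits {n : ℕ} (R : Fin n → Fin n → Prop) (i j : Fin n) :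
    cells (matrixBits R) (i.val * n + j.val) = 2 ↔ R i j := by
  classical
  unfold cells
  rw [matrixBits_getElem?]
  by_cases h : R i j <;> simp [h]

theorem graphCode_length {n : ℕ} (G : SimpleGraph (Fin n)) :
    (graphCode G).length = n + 1 + n * n := by
  simp [graphCode, matrixBits_length]; ring

/-- Append the `reg r × reg r` matrix with entries `e`, where `e` reads its indices in the
registers `0` and `1`. -/
def pushMatrix (r : ℕ) (e : Expr) : Cmd := .loop 0 (.reg r) (.loop 1 (.reg r) (.push e))

/-- `σ'` differs from `σ` at most in the registers `0` and `1` and in the buffer, which is `w`. -/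
structure Extends (σ σ' : Store) (w : List Bool) : Prop where
  reg : ∀ q, 2 ≤ q → σ'.reg q = σ.reg q
  mem : σ'.mem = σ.mem
  buf : σ'.buf = w

theorem Extends.trans {σ σ' σ'' : Store} {w w' : List Bool} (h : Extends σ σ' w)
    (h' : Extends σ' σ'' w') : Extends σ σ'' w' :=
  ⟨fun q hq => (h'.reg q hq).trans (h.reg q hq), h'.mem.trans h.mem, h'.buf⟩

theorem extends_setReg (σ : Store) {q : ℕ} (v : ℕ) (hq : q < 2) :
    Extends σ (σ.setReg q v) σ.buf := by
  refine ⟨fun q' hq' => ?_, rfl, rfl⟩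
  simp [Store.setReg, show q' ≠ q by omega]

/-- The expression `e` describes the matrix of `R`. -/
def Describes (B : ℕ) (σ : Store) (e : Expr) {n : ℕ} (R : Fin n → Fin n → Prop) : Prop :=
  ∀ reg : ℕ → ℕ, (∀ q, 2 ≤ q → reg q = σ.reg q) → ∀ i j : Fin n, reg 0 = i → reg 1 = j →
    (e.IsTrue B reg σ.mem ↔ R i j)

/-- Registers `0` and `1` are the running indices and a description fixes only the others and the
arrays. Hence it remains valid after further symbols have been pushed. -/
theorem Describes.of_extends {B : ℕ} {σ σ' : Store} {w : List Bool} (h : Extends σ σ' w)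
    {e : Expr} {n : ℕ} {R : Fin n → Fin n → Prop} (he : Describes B σ e R) :
    Describes B σ' e R := by
  intro reg hreg i j hi hj
  rw [h.mem]
  exact he reg (fun q hq => (hreg q hq).trans (h.reg q hq)) i j hi hj

theorem run_pushMatrix (O : List Bool → List Bool) {B r n : ℕ} {e : Expr} {σ : Store} (hr : 2 ≤ r)
    (hn : σ.reg r = n) (hB : n ≤ B) {R : Fin n → Fin n → Prop} (he : Describes B σ e R) :
    Extends σ ((pushMatrix r e).run O B σ) (σ.buf ++ matrixBits R) := by
  classical
  -- After `i` rounds of the outer loop the first `i * n` bits have been written; inside, after `j`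
  -- further rounds, the first `i * n + j`.
  have key := Cmd.run_loop_induction (O := O) (B := B) (r := 0) (e := .reg r)
    (c := .loop 1 (.reg r) (.push e)) (σ := σ)
    (fun i τ => Extends σ τ (σ.buf ++ (matrixBits R).take (i * n))) hn hB
    ⟨fun _ _ => rfl, rfl, by simp⟩ ?_
  · rwa [List.take_of_length_le (matrixBits_length R).le] at key
  · intro i hi τ hτ
    have h0 : Extends σ (τ.setReg 0 i) (σ.buf ++ (matrixBits R).take (i * n)) :=
      hτ.trans (hτ.buf ▸ extends_setReg τ i (by omega))
    have key := Cmd.run_loop_induction (O := O) (B := B) (r := 1) (e := .reg r)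
      (c := .push e) (σ := τ.setReg 0 i)
      (fun j ρ => Extends σ ρ (σ.buf ++ (matrixBits R).take (i * n + j)) ∧ ρ.reg 0 = i)
      (by rw [Expr.eval_reg, h0.reg r hr, hn]) hB ⟨h0, by simp [Store.setReg]⟩ ?_
    · have := key.1
      rwa [show i * n + n = (i + 1) * n by ring] at this
    · rintro j hj ρ ⟨hρ, hρi⟩
      have h1 := hρ.trans (hρ.buf ▸ extends_setReg ρ (q := 1) j (by omega))
      refine ⟨⟨h1.reg, h1.mem, ?_⟩, ?_⟩
      · rw [Cmd.run_push]
        have h2 := he (ρ.setReg 1 j).reg h1.reg ⟨i, hi⟩ ⟨j, hj⟩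
          (by simpa [Store.setReg] using hρi) (by simp [Store.setReg])
        have h3 := matrixBits_getElem? R ⟨i, hi⟩ ⟨j, hj⟩
        simp only at h3
        simp only [h1.buf, h1.mem, h2, List.append_assoc]
        rw [← add_assoc, List.take_add_one, h3]
        simp
      · simpa [Cmd.run_push, Store.setReg] using hρi

/-- Append the code of the graph on `reg r` vertices with adjacency matrix `e`. -/
def pushGraph (r : ℕ) (e : Expr) : Cmd :=
  .seq (.loop 0 (.reg r) (.push (.const 1))) (.seq (.push (.const 0)) (pushMatrix r e))

theorem run_pushGraph (O : List Bool → List Bool) {B r n : ℕ} {e : Expr} {σ : Store} (hr : 2 ≤ r)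
    (hn : σ.reg r = n) (hB : n ≤ B) {G : SimpleGraph (Fin n)} (he : Describes B σ e G.Adj) :
    Extends σ ((pushGraph r e).run O B σ) (σ.buf ++ graphCode G) := by
  have h1 := Cmd.run_loop_induction (O := O) (B := B) (r := 0) (e := .reg r)
    (c := .push (.const 1)) (σ := σ)
    (fun i τ => Extends σ τ (σ.buf ++ List.replicate i true)) hn hB
    ⟨fun _ _ => rfl, rfl, by simp⟩ (by
      intro i _ τ hτ
      have h := hτ.trans (hτ.buf ▸ extends_setReg τ i (by omega : 0 < 2))
      refine ⟨h.reg, h.mem, ?_⟩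
      simp [Cmd.run, h.buf, List.replicate_succ'])
  set σ₁ := (Cmd.loop 0 (.reg r) (.push (.const 1))).run O B σ with hσ₁
  have h2 : Extends σ ((Cmd.push (.const 0)).run O B σ₁)
      (σ.buf ++ List.replicate n true ++ [false]) :=
    ⟨h1.reg, h1.mem, by simp [Cmd.run, h1.buf]⟩
  have h3 := run_pushMatrix O hr ((h2.reg r hr).trans hn) hB (he.of_extends h2)
  have h4 := h2.trans h3
  rw [h2.buf] at h4
  rw [graphCode, ← List.singleton_append, ← List.append_assoc, ← List.append_assoc]
  exact h4

/-- Count, in register `r`, the symbols `true` in array `0` from cell `e` on. -/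
def countUnary (r : ℕ) (e : Expr) : Cmd :=
  .seq (.set r (.const 0)) (.loop 0 .bound (.cond (.eq (.load 0 (.add e (.reg r))) (.const 2))
    (.set r (.add (.reg r) (.const 1))) .skip))

/-- The scan always takes `B` rounds, but the cell inspected is given by the counter and not by the
loop index. The counter therefore gets stuck at the first symbol other than `true`, and equals `min
i n` after `i` rounds. -/
theorem run_countUnary (O : List Bool → List Bool) {B r n b : ℕ} {e : Expr} {σ : Store}
    (hr : 2 ≤ r) (hB : n ≤ B)
    (he : ∀ reg : ℕ → ℕ, (∀ q, q ≠ 0 → q ≠ r → reg q = σ.reg q) → e.eval B reg σ.mem = b)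
    (ht : ∀ i < n, σ.mem 0 (b + i) = 2) (hf : σ.mem 0 (b + n) ≠ 2) :
    ((countUnary r e).run O B σ).mem = σ.mem ∧ ((countUnary r e).run O B σ).buf = σ.buf ∧
      ((countUnary r e).run O B σ).reg r = n ∧
      ∀ q, q ≠ 0 → q ≠ r → ((countUnary r e).run O B σ).reg q = σ.reg q := by
  have key := Cmd.run_loop_induction (O := O) (B := B) (r := 0) (e := .bound)
    (c := .cond (.eq (.load 0 (.add e (.reg r))) (.const 2))
      (.set r (.add (.reg r) (.const 1))) .skip) (σ := σ.setReg r 0)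
    (fun i τ => τ.mem = σ.mem ∧ τ.buf = σ.buf ∧ τ.reg r = min i n ∧
      ∀ q, q ≠ 0 → q ≠ r → τ.reg q = σ.reg q) rfl le_rfl
    ⟨rfl, rfl, by simp [Store.setReg], fun q _ hq => by simp [Store.setReg, hq]⟩ ?_
  · rwa [Expr.eval_bound, min_eq_right hB] at key
  · rintro i - τ ⟨hm, hbuf, hτr, hq⟩
    have hr0 : r ≠ 0 := by omega
    have he' := he (τ.setReg 0 i).reg
      (fun q h0 hqr => by simpa [Store.setReg, h0] using hq q h0 hqr)
    have hmem : (τ.setReg 0 i).mem = σ.mem := hm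
    have hreg : (τ.setReg 0 i).reg r = min i n := by simpa [Store.setReg, hr0] using hτr
    rw [Cmd.run_cond]
    simp only [Expr.isTrue_eq, Expr.eval_load, Expr.eval_add, Expr.eval_reg, Expr.eval_const,
      hmem, he', hreg]
    by_cases hi : i < n
    · rw [min_eq_left hi.le, if_pos (ht i hi)]
      refine ⟨hm, hbuf, ?_, fun q h0 hqr => ?_⟩
      · simp [Cmd.run, Store.setReg, hr0, hτr]; omega
      · simpa [Cmd.run, Store.setReg, h0, hqr] using hq q h0 hqr
    · rw [min_eq_right (by omega), if_neg hf]
      refine ⟨hm, hbuf, ?_, fun q h0 hqr => ?_⟩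
      · simp [Cmd.run, Store.setReg, hr0, hτr]; omega
      · simpa [Cmd.run, Store.setReg, h0, hqr] using hq q h0 hqr

end StructuredRAM

/-! ### Attaching labels to the vertices of a graph -/

/-- Adjacency of two vertices that are given by their numbers. -/
def natAdj {n : ℕ} (G : SimpleGraph (Fin n)) (a b : ℕ) : Prop :=
  ∃ (ha : a < n) (hb : b < n), G.Adj ⟨a, ha⟩ ⟨b, hb⟩

theorem natAdj_val {n : ℕ} (G : SimpleGraph (Fin n)) (a b : Fin n) :
    natAdj G a b ↔ G.Adj a b := by
  simp [natAdj]

theorem natAdj_comm {n : ℕ} (G : SimpleGraph (Fin n)) (a b : ℕ) : natAdj G a b ↔ natAdj G b a := by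
  constructor <;> rintro ⟨ha, hb, h⟩ <;> exact ⟨hb, ha, h.symm⟩

theorem natAdj_irrefl {n : ℕ} (G : SimpleGraph (Fin n)) (a : ℕ) : ¬ natAdj G a a := by
  rintro ⟨_, _, h⟩
  exact h.ne rfl

/-- One direction of the adjacency in `labelledGraph`. -/
def labelRel (n : ℕ) (E : ℕ → ℕ → Prop) (pos : ℕ → ℕ) (a b : ℕ) : Prop :=
  (a < n ∧ b < n ∧ E a b) ∨ (a < n ∧ n + pos a ≤ b ∧ b ≤ 2 * n + 1) ∨
    (n ≤ a ∧ n ≤ b ∧ a ≤ 2 * n ∧ b ≤ 2 * n) ∨ (a = 2 * n + 1 ∧ b = 2 * n + 2)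

/-- The graph `G` with labels `pos` between `0` and `n`: there are additional vertices
`n, …, 2n`, which form a clique and of which `n + i` is adjacent to the vertices with label at
most `i`, a vertex `2n + 1` adjacent to all of `G`, and a pendant vertex `2n + 2` at `2n + 1`. -/
def labelledGraph {n : ℕ} (G : SimpleGraph (Fin n)) (pos : ℕ → ℕ) :
    SimpleGraph (Fin (2 * n + 3)) :=
  SimpleGraph.fromRel fun a b => labelRel n (natAdj G) pos a b

theorem labelledGraph_adj {n : ℕ} (G : SimpleGraph (Fin n)) (pos : ℕ → ℕ)
    (a b : Fin (2 * n + 3)) : (labelledGraph G pos).Adj a b ↔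
      a.val ≠ b.val ∧ (labelRel n (natAdj G) pos a b ∨ labelRel n (natAdj G) pos b a) := by
  simp [labelledGraph, Fin.ext_iff]

/-! ### Recovering labels from the uncoloured graph -/

theorem labelledGraph_pendant {n : ℕ} {G : SimpleGraph (Fin n)} {pos : ℕ → ℕ}
    {u a : Fin (2 * n + 3)} (hu : u.val = 2 * n + 2) (h : (labelledGraph G pos).Adj u a) :
    a.val = 2 * n + 1 := by
  rw [labelledGraph_adj] at h
  simp only [labelRel] at h
  omega

/-- This makes `2n + 2` the only vertex with fewer than two neighbours. Labels are at most `n`, so a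
vertex of `G` always sees `2n` and `2n + 1`; the palette is a clique of `n + 1 ≥ 3` vertices, which
is where `2 ≤ n` enters. -/
theorem labelledGraph_not_pendant {n : ℕ} (hn : 2 ≤ n) {G : SimpleGraph (Fin n)} {pos : ℕ → ℕ}
    (hpos : ∀ v < n, pos v ≤ n) {u : Fin (2 * n + 3)} (hu : u.val ≠ 2 * n + 2) :
    ∃ a b, a ≠ b ∧ (labelledGraph G pos).Adj u a ∧ (labelledGraph G pos).Adj u b := by
  have hul := u.isLt
  suffices h : ∃ a b : ℕ, ∃ (ha : a < 2 * n + 3) (hb : b < 2 * n + 3), a ≠ b ∧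
      (labelledGraph G pos).Adj u ⟨a, ha⟩ ∧ (labelledGraph G pos).Adj u ⟨b, hb⟩ by
    obtain ⟨a, b, ha, hb, hab, h⟩ := h
    exact ⟨_, _, by simpa [Fin.ext_iff] using hab, h⟩
  simp only [labelledGraph_adj, labelRel]
  by_cases h1 : u.val < n
  · have := hpos _ h1
    exact ⟨2 * n, 2 * n + 1, by omega, by omega, by omega, by omega, by omega⟩
  by_cases h2 : u.val ≤ 2 * n
  · by_cases h3 : u.val = n
    · exact ⟨n + 1, n + 2, by omega, by omega, by omega, by omega, by omega⟩
    by_cases h4 : u.val = n + 1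
    · exact ⟨n, n + 2, by omega, by omega, by omega, by omega, by omega⟩
    · exact ⟨n, n + 1, by omega, by omega, by omega, by omega, by omega⟩
  · have := hpos 0 (by omega)
    exact ⟨0, 2 * n + 2, by omega, by omega, by omega, by omega, by omega⟩

/-- Two colourings whose sublevel sets are matched by a bijection of the colours agree. -/
theorem eq_of_sublevel_bijection {V : Type*} [Fintype V] {m : ℕ} (c c' : V → ℕ)
    (σ : Equiv.Perm (Fin m)) (hc : ∀ v, c v < m) (hc' : ∀ v, c' v < m)
    (h : ∀ v i, c' v ≤ (σ i).val ↔ c v ≤ i.val) : c' = c := by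
  classical
  let S : Fin m → Finset V := fun i => Finset.univ.filter fun v => c v ≤ i.val
  let S' : Fin m → Finset V := fun i => Finset.univ.filter fun v => c' v ≤ i.val
  have hS : ∀ i, S' (σ i) = S i := fun i => by ext v; simp [S, S', h]
  have monoS : Monotone S := fun i j hij v => by
    simp only [S, Finset.mem_filter, Finset.mem_univ, true_and]
    intro hv
    exact hv.trans hij
  have monoS' : Monotone S' := fun i j hij v => by
    simp only [S', Finset.mem_filter, Finset.mem_univ, true_and]
    intro hv
    exact hv.trans hij
  -- The cardinalities of the sets `S' i` are monotone in `i`, and so is their rearrangement by `σ`,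
  -- because it lists the cardinalities of the sets `S i`. A monotone rearrangement of a tuple is
  -- unique.
  have hcard : (fun i => (S' i).card) ∘ σ = (fun i => (S' i).card) ∘ (1 : Equiv.Perm (Fin m)) := by
    apply Tuple.unique_monotone
    · intro i j hij
      simp only [Function.comp_apply, hS]
      exact Finset.card_le_card (monoS hij)
    · intro i j hij
      exact Finset.card_le_card (monoS' hij)
  -- `S' (σ i)` and `S' i` are nested and equally large, hence equal.
  have hSS : ∀ i, S' i = S i := by
    intro i
    have h1 : (S' (σ i)).card = (S' i).card := congrFun hcard i
    rw [← hS]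
    rcases le_total i (σ i) with hle | hle
    · exact Finset.eq_of_subset_of_card_le (monoS' hle) h1.le
    · exact (Finset.eq_of_subset_of_card_le (monoS' hle) h1.ge).symm
  have hiff : ∀ v (i : Fin m), c' v ≤ i.val ↔ c v ≤ i.val := by
    intro v i
    have := congrArg (v ∈ ·) (hSS i)
    simpa [S, S'] using this
  funext v
  apply le_antisymm
  · exact (hiff v ⟨c v, hc v⟩).2 le_rfl
  · exact (hiff v ⟨c' v, hc' v⟩).1 le_rfl

/-- The parts are recognized in turn: the pendant vertex, its neighbour `2n + 1`, the other
neighbours of that vertex, which form `G`, and the rest, which is the palette. -/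
theorem exists_iso_of_labelledGraph_iso {n : ℕ} (hn : 2 ≤ n) {G H : SimpleGraph (Fin n)}
    {pos pos' : ℕ → ℕ} (hpos : ∀ v < n, pos v ≤ n) (hpos' : ∀ v < n, pos' v ≤ n)
    (φ : labelledGraph G pos ≃g labelledGraph H pos') :
    ∃ ψ : G ≃g H, ∀ v : Fin n, pos' (ψ v) = pos v := by
  have hy : (φ ⟨2 * n + 2, by omega⟩).val = 2 * n + 2 := by
    by_contra hne
    obtain ⟨a, b, hab, ha, hb⟩ := labelledGraph_not_pendant hn hpos' (G := H) hne
    rw [← φ.apply_symm_apply a, φ.map_adj_iff] at ha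
    rw [← φ.apply_symm_apply b, φ.map_adj_iff] at hb
    apply hab
    apply φ.symm.injective
    ext
    rw [labelledGraph_pendant rfl ha, labelledGraph_pendant rfl hb]
  have hd : (φ ⟨2 * n + 1, by omega⟩).val = 2 * n + 1 := by
    refine labelledGraph_pendant (G := H) (pos := pos') hy ?_
    rw [φ.map_adj_iff, labelledGraph_adj]
    simp [labelRel]
  have hV : ∀ u, (φ u).val < n ↔ u.val < n := by
    have char : ∀ (K : SimpleGraph (Fin n)) (p : ℕ → ℕ), (∀ v < n, p v ≤ n) →
        ∀ u d : Fin (2 * n + 3), d.val = 2 * n + 1 →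
        (u.val < n ↔ (labelledGraph K p).Adj u d ∧ u.val ≠ 2 * n + 2) := by
      intro K p hp u d hd
      have hul := u.isLt
      rw [labelledGraph_adj]
      simp only [labelRel]
      by_cases hu : u.val < n
      · have := hp _ hu
        omega
      · omega
    intro u
    rw [char H pos' hpos' _ _ hd, char G pos hpos u ⟨2 * n + 1, by omega⟩ rfl, φ.map_adj_iff]
    have : (φ u).val ≠ 2 * n + 2 ↔ u.val ≠ 2 * n + 2 := by
      have h := φ.injective.eq_iff (a := u) (b := ⟨2 * n + 2, by omega⟩)
      rw [Fin.ext_iff, Fin.ext_iff, hy] at h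
      exact not_congr h
    rw [this]
  -- A palette vertex cannot go into `H`, nor to `2n + 1` or `2n + 2`, whose preimages are already
  -- known.
  have hP : ∀ i : Fin (n + 1), n ≤ (φ ⟨n + i, by omega⟩).val ∧
      (φ ⟨n + i, by omega⟩).val ≤ 2 * n := by
    intro i
    have h1 := hV ⟨n + i, by omega⟩
    have h2 := (φ ⟨n + i, by omega⟩).isLt
    have h3 : (φ ⟨n + i, by omega⟩).val ≠ 2 * n + 2 := by
      rw [← hy, Ne, ← Fin.ext_iff, φ.injective.eq_iff, Fin.ext_iff]
      simp only
      omega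
    have h4 : (φ ⟨n + i, by omega⟩).val ≠ 2 * n + 1 := by
      rw [← hd, Ne, ← Fin.ext_iff, φ.injective.eq_iff, Fin.ext_iff]
      simp only
      omega
    simp only at h1
    omega
  let ι : Fin n → Fin (2 * n + 3) := fun v => ⟨v, by omega⟩
  let ψ₀ : Fin n → Fin n := fun v => ⟨(φ (ι v)).val, (hV (ι v)).2 v.isLt⟩
  have hψ₀ : ∀ v, φ (ι v) = ι (ψ₀ v) := fun v => rfl
  have injψ : Function.Injective ψ₀ := by
    intro v w h
    have : φ (ι v) = φ (ι w) := by rw [hψ₀, hψ₀, h]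
    simpa [ι, Fin.ext_iff] using φ.injective this
  let σ₀ : Fin (n + 1) → Fin (n + 1) := fun i =>
    ⟨(φ ⟨n + i, by omega⟩).val - n, by have := hP i; omega⟩
  have hσ₀ : ∀ i : Fin (n + 1), (φ ⟨n + i, by omega⟩).val = n + (σ₀ i).val := fun i => by
    have := hP i
    simp only [σ₀]
    omega
  have injσ : Function.Injective σ₀ := by
    intro i j h
    have : φ ⟨n + i, by omega⟩ = φ ⟨n + j, by omega⟩ := by
      ext
      rw [hσ₀, hσ₀, h]
    simpa [Fin.ext_iff] using φ.injective this
  let ψ : Equiv.Perm (Fin n) := Equiv.ofBijective ψ₀ (Finite.injective_iff_bijective.1 injψ)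
  let σ : Equiv.Perm (Fin (n + 1)) := Equiv.ofBijective σ₀ (Finite.injective_iff_bijective.1 injσ)
  have adjV : ∀ (K : SimpleGraph (Fin n)) (p : ℕ → ℕ) (v w : Fin n),
      (labelledGraph K p).Adj (ι v) (ι w) ↔ K.Adj v w := by
    intro K p v w
    rw [labelledGraph_adj, ← natAdj_val K v w]
    have h1 := v.isLt
    have h2 := w.isLt
    have h3 := natAdj_comm K v w
    have h4 : natAdj K v w → v.val ≠ w.val := fun h e => natAdj_irrefl K v (by rwa [← e] at h)
    simp only [labelRel, ι, ← h3, h1, h2, true_and]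
    constructor
    · rintro ⟨-, h | h⟩ <;> rcases h with h | h | h | h <;> first | exact h | omega
    · exact fun h => ⟨h4 h, Or.inl (Or.inl h)⟩
  have adjP : ∀ (K : SimpleGraph (Fin n)) (p : ℕ → ℕ) (v : Fin n) (u : Fin (2 * n + 3)) (i : ℕ),
      i ≤ n → u.val = n + i → ((labelledGraph K p).Adj (ι v) u ↔ p v ≤ i) := by
    intro K p v u i hi hu
    rw [labelledGraph_adj]
    have h1 := v.isLt
    simp only [labelRel, ι]
    omega
  refine ⟨⟨ψ, ?_⟩, ?_⟩
  · intro v w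
    change H.Adj (ψ₀ v) (ψ₀ w) ↔ G.Adj v w
    rw [← adjV H pos', ← adjV G pos, ← hψ₀, ← hψ₀, φ.map_adj_iff]
  -- The induced permutation `σ` of the palette need not be the identity; it only matches sublevel
  -- sets, and this suffices.
  · have := eq_of_sublevel_bijection (fun v : Fin n => pos v) (fun v => pos' (ψ₀ v)) σ
      (fun v => Nat.lt_succ_of_le (hpos v v.isLt)) (fun v => Nat.lt_succ_of_le (hpos' _ (ψ₀ v).isLt))
      (by
        intro v i
        change pos' (ψ₀ v) ≤ (σ₀ i).val ↔ pos v ≤ i.val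
        rw [← adjP H pos' (ψ₀ v) (φ ⟨n + i, by omega⟩) _ (by omega) (hσ₀ i), ← hψ₀,
          φ.map_adj_iff, adjP G pos v _ i (by omega) rfl])
    exact fun v => congrFun this v

/-- The offset is `0` for the vertices of a labelled graph and `n` for the second half of a doubled
graph; all auxiliary vertices stay fixed. -/
theorem exists_perm_extending {n N m : ℕ} (h : m + n ≤ N) (ψ : Equiv.Perm (Fin n)) :
    ∃ e : Equiv.Perm (Fin N), (∀ (v : Fin n) (a : Fin N), a.val = m + v → (e a).val = m + ψ v) ∧
      ∀ a, (a.val < m ∨ m + n ≤ a.val) → e a = a := by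
  let ι : Fin n ↪ Fin N := ⟨fun v => ⟨m + v, by omega⟩, fun v w hvw => by
    simpa [Fin.ext_iff] using hvw⟩
  refine ⟨ψ.viaFintypeEmbedding ι, fun v a ha => ?_, fun a ha => ?_⟩
  · obtain rfl : a = ι v := Fin.ext ha
    rw [ψ.viaFintypeEmbedding_apply_image]
    rfl
  · apply Equiv.Perm.viaFintypeEmbedding_apply_notMem_range
    rintro ⟨b, rfl⟩
    have hb : (ι b).val = m + b.val := rfl
    omega

theorem labelledGraph_iso_of_iso {n : ℕ} {G H : SimpleGraph (Fin n)} {pos pos' : ℕ → ℕ}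
    (ψ : G ≃g H) (h : ∀ v : Fin n, pos' (ψ v) = pos v) :
    Nonempty (labelledGraph G pos ≃g labelledGraph H pos') := by
  obtain ⟨e, elt', ele'⟩ := exists_perm_extending (by omega : 0 + n ≤ 2 * n + 3) ψ.toEquiv
  have elt : ∀ (a : Fin (2 * n + 3)) (ha : a.val < n), (e a).val = ψ ⟨a, ha⟩ := fun a ha =>
    (elt' ⟨a, ha⟩ a (zero_add _).symm).trans (zero_add _)
  have ele : ∀ a : Fin (2 * n + 3), n ≤ a.val → e a = a := fun a ha => ele' a (by omega)
  have rel : ∀ a b, labelRel n (natAdj H) pos' (e a).val (e b).val ↔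
      labelRel n (natAdj G) pos a.val b.val := by
    intro a b
    by_cases ha : a.val < n
    · have hpa : pos' (ψ ⟨a, ha⟩) = pos a := h ⟨a, ha⟩
      have hea := elt a ha
      have hla := (ψ ⟨a, ha⟩).isLt
      by_cases hb : b.val < n
      · have heb := elt b hb
        have hlb := (ψ ⟨b, hb⟩).isLt
        have hadj : natAdj H (e a).val (e b).val ↔ natAdj G a b := by
          rw [hea, heb, natAdj_val, ψ.map_adj_iff, ← natAdj_val]
        simp only [labelRel, hadj]
        rw [hea, hpa, heb]
        by_cases hE : natAdj G a b <;> simp only [hE, and_true, and_false, false_or] <;> omega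
      · rw [ele b (by omega), hea]
        simp only [labelRel, hpa]
        omega
    · rw [ele a (by omega)]
      by_cases hb : b.val < n
      · have heb := elt b hb
        have hlb := (ψ ⟨b, hb⟩).isLt
        rw [heb]
        simp only [labelRel]
        omega
      · rw [ele b (by omega)]
        simp only [labelRel]
        omega
  refine ⟨⟨e, ?_⟩⟩
  intro a b
  rw [labelledGraph_adj, labelledGraph_adj, rel, rel, Ne, Ne, ← Fin.ext_iff, ← Fin.ext_iff,
    e.injective.eq_iff]

/-! ### Two graphs side by side -/

/-- One direction of the adjacency of the auxiliary vertices in `doubledGraph`. -/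
def frameRel (n a b : ℕ) : Prop :=
  (a < 2 * n ∧ b = 2 * n + 4) ∨ (a < n ∧ b = 2 * n) ∨ (n ≤ a ∧ a < 2 * n ∧ b = 2 * n + 1) ∨
    (2 * n ≤ a ∧ a ≤ 2 * n + 1 ∧ b = a + 2)

/-- One direction of the adjacency in `doubledGraph`. -/
def doubledRel (n : ℕ) (E E' : ℕ → ℕ → Prop) (a b : ℕ) : Prop :=
  (a < n ∧ b < n ∧ E a b) ∨ (n ≤ a ∧ a < 2 * n ∧ n ≤ b ∧ b < 2 * n ∧ E' (a - n) (b - n)) ∨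
    frameRel n a b

/-- The disjoint union of `X` and `Y`, with a vertex `2n + 4` adjacent to all of it, a vertex `2n`
adjacent to all of `X`, a vertex `2n + 1` adjacent to all of `Y`, and pendant vertices `2n + 2` at
`2n` and `2n + 3` at `2n + 1`. -/
def doubledGraph {n : ℕ} (X Y : SimpleGraph (Fin n)) : SimpleGraph (Fin (2 * n + 5)) :=
  SimpleGraph.fromRel fun a b => doubledRel n (natAdj X) (natAdj Y) a b

theorem doubledGraph_adj {n : ℕ} (X Y : SimpleGraph (Fin n)) (a b : Fin (2 * n + 5)) :
    (doubledGraph X Y).Adj a b ↔ a.val ≠ b.val ∧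
      (doubledRel n (natAdj X) (natAdj Y) a b ∨ doubledRel n (natAdj X) (natAdj Y) b a) := by
  simp [doubledGraph, Fin.ext_iff]

theorem doubledGraph_adj_of_frameRel {n : ℕ} {X Y : SimpleGraph (Fin n)} {a b : Fin (2 * n + 5)}
    (h : frameRel n a b ∨ frameRel n b a) : (doubledGraph X Y).Adj a b := by
  rw [doubledGraph_adj]
  refine ⟨?_, h.imp (fun h => Or.inr (Or.inr h)) (fun h => Or.inr (Or.inr h))⟩
  simp only [frameRel] at h
  omega

/-- Only the position of the edge is retained. This is pure linear arithmetic and still enough for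
every argument about pendants, hubs and fixed edges. -/
theorem doubledGraph_adj_cases {n : ℕ} {X Y : SimpleGraph (Fin n)} {a b : Fin (2 * n + 5)}
    (h : (doubledGraph X Y).Adj a b) : a.val ≠ b.val ∧ ((a.val < n ∧ b.val < n) ∨
      (n ≤ a.val ∧ a.val < 2 * n ∧ n ≤ b.val ∧ b.val < 2 * n) ∨ frameRel n a b ∨
        frameRel n b a) := by
  rw [doubledGraph_adj] at h
  unfold doubledRel at h
  tauto

theorem doubledGraph_adj_left {n : ℕ} {X Y : SimpleGraph (Fin n)} {a b : Fin (2 * n + 5)}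
    (ha : a.val < n) (hb : b.val < n) : (doubledGraph X Y).Adj a b ↔ natAdj X a b := by
  rw [doubledGraph_adj]
  constructor
  · rintro ⟨-, (⟨-, -, h⟩ | ⟨_, _, _, _, _⟩ | h) | (⟨-, -, h⟩ | ⟨_, _, _, _, _⟩ | h)⟩
    · exact h
    · omega
    · simp only [frameRel] at h; omega
    · exact (natAdj_comm X _ _).1 h
    · omega
    · simp only [frameRel] at h; omega
  · exact fun h => ⟨fun e => natAdj_irrefl X _ (by rwa [e] at h), Or.inl (Or.inl ⟨ha, hb, h⟩)⟩

theorem doubledGraph_adj_right {n : ℕ} {X Y : SimpleGraph (Fin n)} {a b : Fin (2 * n + 5)}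
    (ha : n ≤ a.val) (ha' : a.val < 2 * n) (hb : n ≤ b.val) (hb' : b.val < 2 * n) :
    (doubledGraph X Y).Adj a b ↔ natAdj Y (a - n) (b - n) := by
  rw [doubledGraph_adj]
  constructor
  · rintro ⟨-, (⟨_, _, _⟩ | ⟨-, -, -, -, h⟩ | h) | (⟨_, _, _⟩ | ⟨-, -, -, -, h⟩ | h)⟩
    · omega
    · exact h
    · simp only [frameRel] at h; omega
    · omega
    · exact (natAdj_comm Y _ _).1 h
    · simp only [frameRel] at h; omega
  · exact fun h => ⟨fun e => natAdj_irrefl Y _ (by rwa [e] at h),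
      Or.inl (Or.inr (Or.inl ⟨ha, ha', hb, hb', h⟩))⟩

/-- This secures the promise of the PAR query: if `X` and `Y` are isomorphic, then `doubledGraph X
Y` is isomorphic to `doubledGraph X X`, on which an involution is known. -/
theorem doubledGraph_iso {n : ℕ} {X Y Y' : SimpleGraph (Fin n)} (ψ : Y ≃g Y') :
    Nonempty (doubledGraph X Y ≃g doubledGraph X Y') := by
  obtain ⟨e, eV, eO⟩ := exists_perm_extending (by omega : n + n ≤ 2 * n + 5) ψ.toEquiv
  have eV' : ∀ a : Fin (2 * n + 5), n ≤ a.val → a.val < 2 * n →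
      ∃ v : Fin n, a.val = n + v ∧ (e a).val = n + ψ v := fun a h h' =>
    ⟨⟨a - n, by omega⟩, by simp; omega, eV ⟨a - n, by omega⟩ a (by simp; omega)⟩
  have eO' : ∀ a : Fin (2 * n + 5), ¬ (n ≤ a.val ∧ a.val < 2 * n) → e a = a := fun a h =>
    eO a (by omega)
  have hrange : ∀ a, (n ≤ (e a).val ∧ (e a).val < 2 * n ∧ n ≤ a.val ∧ a.val < 2 * n) ∨
      (e a = a ∧ ¬ (n ≤ a.val ∧ a.val < 2 * n)) := by
    intro a
    by_cases ha : n ≤ a.val ∧ a.val < 2 * n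
    · obtain ⟨v, hv, hev⟩ := eV' a ha.1 ha.2
      have := (ψ v).isLt
      exact Or.inl ⟨by omega, by omega, ha⟩
    · exact Or.inr ⟨eO' a ha, ha⟩
  have frame : ∀ a b, frameRel n (e a).val (e b).val ↔ frameRel n a.val b.val := by
    intro a b
    simp only [frameRel]
    rcases hrange a with ha | ⟨ha, ha'⟩ <;> rcases hrange b with hb | ⟨hb, hb'⟩ <;>
      (try rw [ha]) <;> (try rw [hb]) <;> omega
  have left : ∀ a b : Fin (2 * n + 5), ((e a).val < n ∧ (e b).val < n ∧ natAdj X (e a) (e b)) ↔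
      (a.val < n ∧ b.val < n ∧ natAdj X a b) := by
    intro a b
    rcases hrange a with ha | ⟨ha, ha'⟩
    · exact ⟨fun h => by omega, fun h => by omega⟩
    rcases hrange b with hb | ⟨hb, hb'⟩
    · exact ⟨fun h => by omega, fun h => by omega⟩
    rw [ha, hb]
  have right : ∀ a b : Fin (2 * n + 5), (n ≤ (e a).val ∧ (e a).val < 2 * n ∧ n ≤ (e b).val ∧
      (e b).val < 2 * n ∧ natAdj Y' ((e a).val - n) ((e b).val - n)) ↔
      (n ≤ a.val ∧ a.val < 2 * n ∧ n ≤ b.val ∧ b.val < 2 * n ∧ natAdj Y (a.val - n) (b.val - n)) := by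
    intro a b
    rcases hrange a with ⟨h1, h2, h3, h4⟩ | ⟨ha, ha'⟩
    · rcases hrange b with ⟨h5, h6, h7, h8⟩ | ⟨hb, hb'⟩
      · obtain ⟨v, hv, hev⟩ := eV' a h3 h4
        obtain ⟨w, hw, hew⟩ := eV' b h7 h8
        have hadj : natAdj Y' ((e a).val - n) ((e b).val - n) ↔
            natAdj Y (a.val - n) (b.val - n) := by
          simp only [hev, hew, hv, hw, Nat.add_sub_cancel_left, natAdj_val, ψ.map_adj_iff]
        simp only [h1, h2, h3, h4, h5, h6, h7, h8, hadj]
      · rw [hb]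
        exact ⟨fun h => by omega, fun h => by omega⟩
    · rw [ha]
      exact ⟨fun h => by omega, fun h => by omega⟩
  have rel : ∀ a b, doubledRel n (natAdj X) (natAdj Y') (e a).val (e b).val ↔
      doubledRel n (natAdj X) (natAdj Y) a.val b.val := fun a b =>
    or_congr (left a b) (or_congr (right a b) (frame a b))
  refine ⟨⟨e, ?_⟩⟩
  intro a b
  rw [doubledGraph_adj, doubledGraph_adj, rel, rel, Ne, Ne, ← Fin.ext_iff, ← Fin.ext_iff,
    e.injective.eq_iff]

/-- The exchange of the two halves of `doubledGraph X X`, on the numbers of the vertices. -/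
def exchange (n a : ℕ) : ℕ :=
  if a < n then a + n else if a < 2 * n then a - n else if a = 2 * n then 2 * n + 1
  else if a = 2 * n + 1 then 2 * n else if a = 2 * n + 2 then 2 * n + 3
  else if a = 2 * n + 3 then 2 * n + 2 else a

/-- The graph of `exchange`. -/
def exchangeRel (n a b : ℕ) : Prop :=
  (a < n ∧ b = a + n) ∨ (b < n ∧ a = b + n) ∨ (a = 2 * n ∧ b = 2 * n + 1) ∨
    (a = 2 * n + 1 ∧ b = 2 * n) ∨ (a = 2 * n + 2 ∧ b = 2 * n + 3) ∨
    (a = 2 * n + 3 ∧ b = 2 * n + 2) ∨ (a = 2 * n + 4 ∧ b = 2 * n + 4)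

/-- As a disjunction of linear conditions the exchange is accessible to `omega`, and it can be
copied literally into the expression by which the program writes the permutation matrix. -/
theorem exchangeRel_exchange {n a : ℕ} (ha : a < 2 * n + 5) : exchangeRel n a (exchange n a) := by
  unfold exchange exchangeRel
  split_ifs <;> omega

theorem exchangeRel_unique {n a b c : ℕ} (h : exchangeRel n b a) (h' : exchangeRel n b c) :
    a = c := by
  unfold exchangeRel at h h'
  omega

theorem exchangeRel_symm {n a b : ℕ} (h : exchangeRel n a b) : exchangeRel n b a := by
  unfold exchangeRel at h ⊢
  omega

theorem exchangeRel_lt {n a b : ℕ} (h : exchangeRel n a b) : b < 2 * n + 5 := by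
  unfold exchangeRel at h
  omega

/-- The exchange of the two halves of `doubledGraph X X`. -/
def exchangePerm (n : ℕ) : Equiv.Perm (Fin (2 * n + 5)) :=
  Function.Involutive.toPerm
    (fun a => ⟨exchange n a, exchangeRel_lt (exchangeRel_exchange a.isLt)⟩)
    (fun a => Fin.ext (exchangeRel_unique
      (exchangeRel_exchange (exchangeRel_lt (exchangeRel_exchange a.isLt)))
      (exchangeRel_symm (exchangeRel_exchange a.isLt))))

theorem exchangePerm_val (n : ℕ) (a : Fin (2 * n + 5)) :
    (exchangePerm n a).val = exchange n a := rfl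

theorem exchangePerm_eq_iff {n : ℕ} (a b : Fin (2 * n + 5)) :
    exchangePerm n a = b ↔ exchangeRel n a b := by
  rw [Fin.ext_iff, exchangePerm_val]
  exact ⟨fun h => h ▸ exchangeRel_exchange a.isLt,
    fun h => exchangeRel_unique (exchangeRel_exchange a.isLt) h⟩

/-- A fixed edge would have both ends fixed or interchanged. The apex `2n + 4` is the only fixed
vertex, and no vertex is adjacent to its image unless it equals it, since there are no edges between
the halves, the hubs or the pendants. -/
theorem exchangePerm_involution {n : ℕ} (X : SimpleGraph (Fin n)) :
    IsFixedEdgeFreeInvolution (doubledGraph X X) (exchangePerm n) := by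
  have sq : ∀ a, exchangePerm n (exchangePerm n a) = a := Function.Involutive.toPerm_involutive _
  have rel : ∀ a b : Fin (2 * n + 5), doubledRel n (natAdj X) (natAdj X) a b →
      doubledRel n (natAdj X) (natAdj X) (exchange n a) (exchange n b) := by
    rintro a b (⟨ha, hb, h⟩ | ⟨ha, ha', hb, hb', h⟩ | h)
    · have e1 : exchange n a = a + n := by simp [exchange, ha]
      have e2 : exchange n b = b + n := by simp [exchange, hb]
      rw [e1, e2]
      exact Or.inr (Or.inl ⟨by omega, by omega, by omega, by omega, by simpa using h⟩)
    · have e1 : exchange n a = a - n := by simp [exchange, ha, ha']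
      have e2 : exchange n b = b - n := by simp [exchange, hb, hb']
      rw [e1, e2]
      exact Or.inl ⟨by omega, by omega, h⟩
    · refine Or.inr (Or.inr ?_)
      have h1 := exchangeRel_exchange a.isLt
      have h2 := exchangeRel_exchange b.isLt
      unfold exchangeRel at h1 h2
      unfold frameRel at h ⊢
      rcases h with h | h | h | h <;> omega
  have adj : ∀ a b, (doubledGraph X X).Adj a b →
      (doubledGraph X X).Adj (exchangePerm n a) (exchangePerm n b) := by
    intro a b h
    refine (doubledGraph_adj _ _ _ _).2 ⟨fun e => h.ne ((exchangePerm n).injective (Fin.ext e)), ?_⟩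
    exact ((doubledGraph_adj _ _ _ _).1 h).2.imp (rel a b) (rel b a)
  refine ⟨fun a b => ⟨fun h => ?_, adj a b⟩, ?_, ?_⟩
  · simpa only [sq] using adj _ _ h
  · refine orderOf_eq_prime ?_ ?_
    · ext a
      simp [pow_two, sq]
    · intro h
      have := congrArg Fin.val (Equiv.Perm.congr_fun h ⟨2 * n, by omega⟩)
      have h1 := exchangeRel_exchange (n := n) (a := 2 * n) (by omega)
      simp only [exchangePerm_val, Equiv.Perm.one_apply] at this
      rw [this] at h1
      unfold exchangeRel at h1
      omega
  · intro e
    induction e with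
    | h a b =>
      intro h h'
      obtain ⟨hne, hr⟩ := doubledGraph_adj_cases h
      rw [Sym2.map_mk, Sym2.eq_iff, exchangePerm_eq_iff, exchangePerm_eq_iff,
        exchangePerm_eq_iff] at h'
      simp only [frameRel] at hr
      simp only [exchangeRel] at h'
      omega

/-! ### Rigidity of the frame -/

theorem doubledGraph_pendant {n : ℕ} {X Y : SimpleGraph (Fin n)} {u a : Fin (2 * n + 5)}
    (hu : u.val = 2 * n + 2 ∨ u.val = 2 * n + 3) (h : (doubledGraph X Y).Adj u a) :
    a.val + 2 = u.val := by
  obtain ⟨-, h⟩ := doubledGraph_adj_cases h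
  simp only [frameRel] at h
  omega

/-- The apex is needed here: without it, an isolated vertex of `X` or `Y` would be adjacent to its
hub only and look like a pendant. -/
theorem doubledGraph_not_pendant {n : ℕ} (hn : 1 ≤ n) {X Y : SimpleGraph (Fin n)}
    {u : Fin (2 * n + 5)} (h2 : u.val ≠ 2 * n + 2) (h3 : u.val ≠ 2 * n + 3) :
    ∃ a b, a ≠ b ∧ (doubledGraph X Y).Adj u a ∧ (doubledGraph X Y).Adj u b := by
  have hul := u.isLt
  suffices h : ∃ a b : ℕ, ∃ (ha : a < 2 * n + 5) (hb : b < 2 * n + 5), a ≠ b ∧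
      (frameRel n u a ∨ frameRel n a u) ∧ (frameRel n u b ∨ frameRel n b u) by
    obtain ⟨a, b, ha, hb, hab, h, h'⟩ := h
    exact ⟨⟨a, ha⟩, ⟨b, hb⟩, by simpa [Fin.ext_iff] using hab, doubledGraph_adj_of_frameRel h,
      doubledGraph_adj_of_frameRel h'⟩
  simp only [frameRel]
  by_cases h1 : u.val < n
  · exact ⟨2 * n, 2 * n + 4, by omega, by omega, by omega, by omega, by omega⟩
  by_cases h1 : u.val < 2 * n
  · exact ⟨2 * n + 1, 2 * n + 4, by omega, by omega, by omega, by omega, by omega⟩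
  by_cases h1 : u.val = 2 * n
  · exact ⟨0, 2 * n + 2, by omega, by omega, by omega, by omega, by omega⟩
  by_cases h1 : u.val = 2 * n + 1
  · exact ⟨n, 2 * n + 3, by omega, by omega, by omega, by omega, by omega⟩
  · exact ⟨0, n, by omega, by omega, by omega, by omega, by omega⟩

/-- A fixed-edge-free involution of `doubledGraph X Y` maps `X` to `Y`. -/
theorem exchanges_of_involution {n : ℕ} {X Y : SimpleGraph (Fin n)}
    {α : Equiv.Perm (Fin (2 * n + 5))} (hα : IsFixedEdgeFreeInvolution (doubledGraph X Y) α)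
    (v : Fin (2 * n + 5)) (hv : v.val < n) : n ≤ (α v).val ∧ (α v).val < 2 * n := by
  have hn : 1 ≤ n := by omega
  let a₀ : Fin (2 * n + 5) := ⟨2 * n, by omega⟩
  let b₀ : Fin (2 * n + 5) := ⟨2 * n + 2, by omega⟩
  have hab : (doubledGraph X Y).Adj b₀ a₀ :=
    doubledGraph_adj_of_frameRel (Or.inr (Or.inr (Or.inr (Or.inr
      ⟨le_rfl, Nat.le_succ _, rfl⟩))))
  have hαab := (hα.1 b₀ a₀).2 hab
  have hb : (α b₀).val = 2 * n + 2 ∨ (α b₀).val = 2 * n + 3 := by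
    by_contra hne
    rw [not_or] at hne
    obtain ⟨a, b, hab, ha, hb⟩ := doubledGraph_not_pendant hn (X := X) (Y := Y) hne.1 hne.2
    rw [← α.apply_symm_apply a, hα.1] at ha
    rw [← α.apply_symm_apply b, hα.1] at hb
    apply hab
    apply α.symm.injective
    have h1 := doubledGraph_pendant (Or.inl rfl) ha
    have h2 := doubledGraph_pendant (Or.inl rfl) hb
    ext
    omega
  have hαa := doubledGraph_pendant hb hαab
  -- If the pendant were fixed, its only neighbour would be fixed as well, and with it the edge
  -- between them.
  have hb' : (α b₀).val = 2 * n + 3 := by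
    refine hb.resolve_left fun h => ?_
    refine hα.2.2 s(b₀, a₀) hab ?_
    have e1 : α b₀ = b₀ := Fin.ext h
    have e2 : α a₀ = a₀ := Fin.ext (show (α a₀).val = 2 * n by omega)
    rw [Sym2.map_mk, e1, e2]
  -- The image of the first hub is now `2n + 1`, whose neighbours are the vertices of `Y` and the
  -- pendant `2n + 3`; the latter is already the image of `b₀`.
  have hadj : (doubledGraph X Y).Adj (α v) (α a₀) :=
    (hα.1 _ _).2 (doubledGraph_adj_of_frameRel (Or.inl (Or.inr (Or.inl ⟨hv, rfl⟩))))
  have hne : (α v).val ≠ 2 * n + 3 := by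
    rw [← hb']
    intro h
    have := congrArg Fin.val (α.injective (Fin.ext h))
    simp only [b₀] at this
    omega
  obtain ⟨-, hadj⟩ := doubledGraph_adj_cases hadj
  simp only [frameRel] at hadj
  omega

theorem adj_iff_of_involution {n : ℕ} {X Y : SimpleGraph (Fin n)}
    {α : Equiv.Perm (Fin (2 * n + 5))} (hα : IsFixedEdgeFreeInvolution (doubledGraph X Y) α)
    (v w : Fin (2 * n + 5)) (hv : v.val < n) (hw : w.val < n) :
    natAdj Y ((α v).val - n) ((α w).val - n) ↔ natAdj X v w := by
  obtain ⟨h1, h2⟩ := exchanges_of_involution hα v hv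
  obtain ⟨h3, h4⟩ := exchanges_of_involution hα w hw
  rw [← doubledGraph_adj_right (X := X) h1 h2 h3 h4, hα.1, doubledGraph_adj_left hv hw]

/-! ### Transport of involutions -/

/-- The new involution is `φ⁻¹βφ`, and `φ` carries each edge that it fixes to an edge fixed by `β`.
-/
theorem IsFixedEdgeFreeInvolution.conj {n : ℕ} {G H : SimpleGraph (Fin n)}
    {β : Equiv.Perm (Fin n)} (hβ : IsFixedEdgeFreeInvolution H β) (φ : G ≃g H) :
    IsFixedEdgeFreeInvolution G (φ.toEquiv.symm.permCongr β) := by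
  have hα : ∀ a, φ (φ.toEquiv.symm.permCongr β a) = β (φ a) := fun a =>
    φ.apply_symm_apply _
  refine ⟨fun u v => ?_, ?_, ?_⟩
  · rw [← φ.map_adj_iff, hα, hα, hβ.1, φ.map_adj_iff]
  · rw [← hβ.2.1]
    exact (φ.toEquiv.symm.permCongrHom).orderOf_eq β
  · intro e
    induction e with
    | h a b =>
      intro h h'
      refine hβ.2.2 s(φ a, φ b) ((φ.map_adj_iff).2 h) ?_
      have := congrArg (Sym2.map φ) h'
      simpa only [Sym2.map_mk, hα] using this

namespace StructuredRAM

open OracleRAM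

/-! ### Reading the input -/

theorem cells_graphCode_of_lt {n : ℕ} (G : SimpleGraph (Fin n)) (w : List Bool) {i : ℕ}
    (hi : i < n) : cells (graphCode G ++ w) i = 2 := by
  unfold cells graphCode
  rw [List.append_assoc, List.getElem?_append_left (by simpa using hi)]
  simp [hi]

theorem cells_graphCode_self {n : ℕ} (G : SimpleGraph (Fin n)) (w : List Bool) :
    cells (graphCode G ++ w) n = 1 := by
  unfold cells graphCode
  rw [List.append_assoc, List.getElem?_append_right (by simp)]
  simp

/-- The array `f` contains the `n × n` matrix of `E` from cell `off` on. -/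
def HasMatrix (f : ℕ → ℕ) (n off : ℕ) (E : ℕ → ℕ → Prop) : Prop :=
  ∀ a < n, ∀ b < n, (f (off + (a * n + b)) = 2 ↔ E a b)

theorem HasMatrix.append {n off : ℕ} {E : ℕ → ℕ → Prop} {w : List Bool}
    (h : HasMatrix (cells w) n off E) (w' : List Bool) :
    HasMatrix (cells (w' ++ w)) n (w'.length + off) E := by
  intro a ha b hb
  rw [add_assoc, cells_append_add]
  exact h a ha b hb

theorem hasMatrix_graphCode {n : ℕ} (G : SimpleGraph (Fin n)) (w : List Bool) :
    HasMatrix (cells (graphCode G ++ w)) n (n + 1) (natAdj G) := by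
  intro a ha b hb
  have hlt : a * n + b < n * n := by
    calc a * n + b < a * n + n := by omega
      _ = (a + 1) * n := by ring
      _ ≤ n * n := Nat.mul_le_mul_right _ (by omega)
  rw [cells_append_of_lt (by rw [graphCode_length]; omega)]
  have : graphCode G = (List.replicate n true ++ [false]) ++ matrixBits G.Adj := by
    simp [graphCode]
  rw [this]
  have hl : n + 1 = (List.replicate n true ++ [false]).length := by simp
  rw [hl]
  rw [cells_append_add]
  exact (cells_matrixBits G.Adj ⟨a, ha⟩ ⟨b, hb⟩).trans (natAdj_val G ⟨a, ha⟩ ⟨b, hb⟩).symm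

/-- Find the sizes of the two graphs at the beginning of the input (in registers `2` and `3`) and
the positions of their adjacency matrices (in registers `4` and `5`). Register `10` contains the
length of the code of the first graph. -/
def parse : Cmd :=
  .seq (countUnary 2 (.const 0)) (.seq (.set 4 (.add (.reg 2) (.const 1)))
    (.seq (.set 10 (.add (.reg 4) (.mul (.reg 2) (.reg 2)))) (.seq (countUnary 3 (.reg 10))
    (.set 5 (.add (.reg 10) (.add (.reg 3) (.const 1)))))))

theorem run_parse (O : List Bool → List Bool) {n m B : ℕ} (X : SimpleGraph (Fin n))
    (Y : SimpleGraph (Fin m)) (w : List Bool) (hn : n ≤ B) (hm : m ≤ B) :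
    ∃ reg : ℕ → ℕ, parse.run O B (initStore (graphCode X ++ (graphCode Y ++ w))) =
        ⟨reg, (initStore (graphCode X ++ (graphCode Y ++ w))).mem, []⟩ ∧
      reg 2 = n ∧ reg 3 = m ∧ reg 4 = n + 1 ∧ reg 5 = n + 1 + n * n + (m + 1) ∧
      reg 10 = n + 1 + n * n := by
  set σ := initStore (graphCode X ++ (graphCode Y ++ w)) with hσ
  have hmem : σ.mem 0 = cells (graphCode X ++ (graphCode Y ++ w)) := by simp [hσ, initStore]
  have hmem' : ∀ i, σ.mem 0 (n + 1 + n * n + i) = cells (graphCode Y ++ w) i := by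
    intro i
    rw [hmem, ← graphCode_length X, cells_append_add]
  obtain ⟨m₁, b₁, v₁, f₁⟩ := run_countUnary O (B := B) (r := 2) (n := n) (b := 0) (e := .const 0)
    (σ := σ) le_rfl hn (fun _ _ => rfl)
    (fun i hi => by rw [zero_add, hmem]; exact cells_graphCode_of_lt X _ hi)
    (by rw [zero_add, hmem, cells_graphCode_self]; decide)
  set σ₁ := (countUnary 2 (.const 0)).run O B σ
  set σ₂ := (σ₁.setReg 4 (n + 1)).setReg 10 (n + 1 + n * n) with hσ₂
  have h₂ : (Cmd.set 10 (.add (.reg 4) (.mul (.reg 2) (.reg 2)))).run O B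
      ((Cmd.set 4 (.add (.reg 2) (.const 1))).run O B σ₁) = σ₂ := by
    simp [Cmd.run, hσ₂, Store.setReg, v₁, hn]
  have m₂ : σ₂.mem = σ.mem := m₁
  obtain ⟨m₃, b₃, v₃, f₃⟩ := run_countUnary O (B := B) (r := 3) (n := m) (b := n + 1 + n * n)
    (e := .reg 10) (σ := σ₂) (by omega) hm
    (fun reg h => by rw [Expr.eval_reg, h 10 (by omega) (by omega)]; simp [hσ₂, Store.setReg])
    (fun i hi => by rw [m₂, hmem']; exact cells_graphCode_of_lt Y _ hi)
    (by rw [m₂, hmem', cells_graphCode_self]; decide)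
  set σ₃ := (countUnary 3 (.reg 10)).run O B σ₂ with hσ₃
  have hrun : parse.run O B σ = σ₃.setReg 5 (σ₃.reg 10 + (σ₃.reg 3 + 1)) := by
    change (Cmd.set 5 _).run O B ((countUnary 3 (.reg 10)).run O B _) = _
    rw [h₂]
    rfl
  have r10 : σ₃.reg 10 = n + 1 + n * n := by
    rw [f₃ 10 (by omega) (by omega)]; simp [hσ₂, Store.setReg]
  have r4 : σ₃.reg 4 = n + 1 := by
    rw [f₃ 4 (by omega) (by omega)]; simp [hσ₂, Store.setReg]
  have r2 : σ₃.reg 2 = n := by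
    rw [f₃ 2 (by omega) (by omega)]; simp [hσ₂, Store.setReg, v₁]
  refine ⟨(σ₃.setReg 5 (σ₃.reg 10 + (σ₃.reg 3 + 1))).reg, ?_, ?_, ?_, ?_, ?_, ?_⟩
  · rw [hrun]
    have hb : σ₃.buf = [] := by rw [b₃]; exact b₁
    have hm : σ₃.mem = σ.mem := m₃.trans m₂
    simp [Store.setReg, hb, hm]
  · simpa [Store.setReg] using r2
  · simpa [Store.setReg] using v₃
  · simpa [Store.setReg] using r4
  · simp [Store.setReg, r10, v₃]
  · simpa [Store.setReg] using r10

/-! ### Expressions for adjacency -/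

/-- The entry `(a, b)` of the matrix that begins in array `0` at the cell given by register `off`;
its size is in register `2`. -/
def bit (off : ℕ) (a b : Expr) : Expr :=
  .eq (.load 0 (.add (.reg off) (.add (.mul a (.reg 2)) b))) (.const 2)

/-- The row index is below `n ≤ B`, so the product in the address is not cut off. -/
theorem isTrue_bit {B n off : ℕ} {reg : ℕ → ℕ} {mem : ℕ → ℕ → ℕ} {E : ℕ → ℕ → Prop} {a b : Expr}
    (hn : reg 2 = n) (hB : n ≤ B) (hE : HasMatrix (mem 0) n (reg off) E)
    (ha : a.eval B reg mem < n) (hb : b.eval B reg mem < n) :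
    (bit off a b).IsTrue B reg mem ↔ E (a.eval B reg mem) (b.eval B reg mem) := by
  simp only [bit, Expr.isTrue_eq, Expr.eval_load, Expr.eval_add, Expr.eval_mul, Expr.eval_reg,
    Expr.eval_const, hn]
  rw [min_eq_left (by omega)]
  exact hE _ ha _ hb

/-- `2 * reg 2 + k` -/
def twiceAdd (k : ℕ) : Expr := .add (.add (.reg 2) (.reg 2)) (.const k)

theorem eval_twiceAdd {B n k : ℕ} {reg : ℕ → ℕ} {mem : ℕ → ℕ → ℕ} (hn : reg 2 = n) :
    (twiceAdd k).eval B reg mem = 2 * n + k := by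
  simp [twiceAdd, hn]; omega

/-- The symmetric and irreflexive relation generated by `e`, between registers `0` and `1`. -/
def symmetrize (e : Expr → Expr → Expr) : Expr :=
  .and (.not (.eq (.reg 0) (.reg 1))) (.or (e (.reg 0) (.reg 1)) (e (.reg 1) (.reg 0)))

def frameExpr (a b : Expr) : Expr :=
  .or (.and (.lt a (twiceAdd 0)) (.eq b (twiceAdd 4)))
    (.or (.and (.lt a (.reg 2)) (.eq b (twiceAdd 0)))
    (.or (.and (.le (.reg 2) a) (.and (.lt a (twiceAdd 0)) (.eq b (twiceAdd 1))))
    (.and (.le (twiceAdd 0) a) (.and (.le a (twiceAdd 1)) (.eq b (.add a (.const 2)))))))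

def doubledExpr (off off' : ℕ) (a b : Expr) : Expr :=
  .or (.and (.lt a (.reg 2)) (.and (.lt b (.reg 2)) (bit off a b)))
    (.or (.and (.le (.reg 2) a) (.and (.lt a (twiceAdd 0)) (.and (.le (.reg 2) b)
      (.and (.lt b (twiceAdd 0)) (bit off' (.sub a (.reg 2)) (.sub b (.reg 2)))))))
    (frameExpr a b))

/-- The expression copies `doubledRel` clause by clause. The range conditions come before each
matrix entry because the contents of the array are meaningful for indices below `n` only. -/
theorem isTrue_doubledExpr {B n off off' : ℕ} {reg : ℕ → ℕ} {mem : ℕ → ℕ → ℕ}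
    {E E' : ℕ → ℕ → Prop} (hn : reg 2 = n) (hB : n ≤ B)
    (hE : HasMatrix (mem 0) n (reg off) E) (hE' : HasMatrix (mem 0) n (reg off') E')
    (a b : Expr) : (doubledExpr off off' a b).IsTrue B reg mem ↔
      doubledRel n E E' (a.eval B reg mem) (b.eval B reg mem) := by
  simp only [doubledExpr, frameExpr, Expr.isTrue_or, Expr.isTrue_and, Expr.isTrue_lt,
    Expr.isTrue_le, Expr.isTrue_eq, Expr.eval_reg, Expr.eval_add, Expr.eval_const,
    eval_twiceAdd hn, hn, doubledRel, frameRel, add_zero]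
  refine or_congr (and_congr_right fun ha => and_congr_right fun hb => isTrue_bit hn hB hE ha hb)
    (or_congr (and_congr_right fun h1 => and_congr_right fun h2 => and_congr_right fun h3 =>
      and_congr_right fun h4 => ?_) Iff.rfl)
  have e1 : (Expr.sub a (.reg 2)).eval B reg mem = a.eval B reg mem - n := by simp [hn]
  have e2 : (Expr.sub b (.reg 2)).eval B reg mem = b.eval B reg mem - n := by simp [hn]
  rw [isTrue_bit hn hB hE' (by omega) (by omega), e1, e2]

theorem describes_doubledGraph {B n off off' : ℕ} {σ : Store} {X Y : SimpleGraph (Fin n)}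
    (hn : σ.reg 2 = n) (hB : n ≤ B) (ho : 2 ≤ off) (ho' : 2 ≤ off')
    (hX : HasMatrix (σ.mem 0) n (σ.reg off) (natAdj X))
    (hY : HasMatrix (σ.mem 0) n (σ.reg off') (natAdj Y)) :
    Describes B σ (symmetrize (doubledExpr off off')) (doubledGraph X Y).Adj := by
  intro reg hreg i j hi hj
  rw [← hreg off ho] at hX
  rw [← hreg off' ho'] at hY
  have hn' : reg 2 = n := (hreg 2 le_rfl).trans hn
  simp only [symmetrize, Expr.isTrue_and, Expr.isTrue_not, Expr.isTrue_eq, Expr.isTrue_or,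
    isTrue_doubledExpr hn' hB hX hY, Expr.eval_reg, hi, hj, doubledGraph_adj, ne_eq]

def exchangeExpr : Expr :=
  let a : Expr := .reg 0
  let b : Expr := .reg 1
  .or (.and (.lt a (.reg 2)) (.eq b (.add a (.reg 2))))
    (.or (.and (.lt b (.reg 2)) (.eq a (.add b (.reg 2))))
    (.or (.and (.eq a (twiceAdd 0)) (.eq b (twiceAdd 1)))
    (.or (.and (.eq a (twiceAdd 1)) (.eq b (twiceAdd 0)))
    (.or (.and (.eq a (twiceAdd 2)) (.eq b (twiceAdd 3)))
    (.or (.and (.eq a (twiceAdd 3)) (.eq b (twiceAdd 2)))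
    (.and (.eq a (twiceAdd 4)) (.eq b (twiceAdd 4))))))))

theorem describes_exchangePerm {B n : ℕ} {σ : Store} (hn : σ.reg 2 = n) :
    Describes B σ exchangeExpr (fun a b : Fin (2 * n + 5) => exchangePerm n a = b) := by
  intro reg hreg i j hi hj
  have hn' : reg 2 = n := (hreg 2 le_rfl).trans hn
  change _ ↔ exchangePerm n i = j
  rw [exchangePerm_eq_iff]
  simp only [exchangeExpr, Expr.isTrue_or, Expr.isTrue_and, Expr.isTrue_lt, Expr.isTrue_eq,
    Expr.eval_reg, Expr.eval_add, eval_twiceAdd hn', hn', hi, hj, exchangeRel, add_zero]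

def labelExpr (off A : ℕ) (a b : Expr) : Expr :=
  .or (.and (.lt a (.reg 2)) (.and (.lt b (.reg 2)) (bit off a b)))
    (.or (.and (.lt a (.reg 2)) (.and (.le (.add (.reg 2) (.load A a)) b) (.le b (twiceAdd 1))))
    (.or (.and (.le (.reg 2) a) (.and (.le (.reg 2) b) (.and (.le a (twiceAdd 0))
      (.le b (twiceAdd 0)))))
    (.and (.eq a (twiceAdd 1)) (.eq b (twiceAdd 2)))))

theorem describes_labelledGraph {B n off A : ℕ} {σ : Store} {G : SimpleGraph (Fin n)}
    (hn : σ.reg 2 = n) (hB : n ≤ B) (ho : 2 ≤ off)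
    (hG : HasMatrix (σ.mem 0) n (σ.reg off) (natAdj G)) :
    Describes B σ (symmetrize (labelExpr off A)) (labelledGraph G (σ.mem A)).Adj := by
  intro reg hreg i j hi hj
  rw [← hreg off ho] at hG
  have hn' : reg 2 = n := (hreg 2 le_rfl).trans hn
  have key : ∀ a b : Expr, (labelExpr off A a b).IsTrue B reg σ.mem ↔
      labelRel n (natAdj G) (σ.mem A) (a.eval B reg σ.mem) (b.eval B reg σ.mem) := by
    intro a b
    simp only [labelExpr, Expr.isTrue_or, Expr.isTrue_and, Expr.isTrue_lt, Expr.isTrue_le,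
      Expr.isTrue_eq, Expr.eval_reg, Expr.eval_add, Expr.eval_load, eval_twiceAdd hn', hn',
      labelRel, add_zero]
    exact or_congr (and_congr_right fun ha => and_congr_right fun hb =>
      isTrue_bit hn' hB hG ha hb) Iff.rfl
  simp only [symmetrize, Expr.isTrue_and, Expr.isTrue_not, Expr.isTrue_eq, Expr.isTrue_or,
    key, Expr.eval_reg, hi, hj, labelledGraph_adj, ne_eq]

end StructuredRAM

namespace StructuredRAM

open OracleRAM

/-! ### Deciding isomorphism by reconstruction of an involution -/

/-- Set register `9` to `1` if `e` is false for all values below `reg 2` of the registers `7` and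
`8`, and to `0` otherwise. -/
def checkPairs (e : Expr) : Cmd :=
  .seq (.set 9 (.const 1)) (.loop 7 (.reg 2) (.loop 8 (.reg 2) (.cond e (.set 9 (.const 0)) .skip)))

theorem run_checkPairs (O : List Bool → List Bool) {B n : ℕ} {e : Expr} {σ : Store}
    (hn : σ.reg 2 = n) (hB : n ≤ B) {bad : ℕ → ℕ → Prop}
    (he : ∀ reg : ℕ → ℕ, (∀ q, q ≠ 7 → q ≠ 8 → q ≠ 9 → reg q = σ.reg q) → reg 7 < n → reg 8 < n →
      (e.IsTrue B reg σ.mem ↔ bad (reg 7) (reg 8))) :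
    ((checkPairs e).run O B σ).buf = σ.buf ∧
      (((checkPairs e).run O B σ).reg 9 ≠ 0 ↔ ∀ i < n, ∀ k < n, ¬ bad i k) := by
  have key := Cmd.run_loop_induction (O := O) (B := B) (r := 7) (e := .reg 2)
    (c := .loop 8 (.reg 2) (.cond e (.set 9 (.const 0)) .skip)) (σ := σ.setReg 9 1)
    (fun i τ => τ.mem = σ.mem ∧ τ.buf = σ.buf ∧
      (∀ q, q ≠ 7 → q ≠ 8 → q ≠ 9 → τ.reg q = σ.reg q) ∧
      (τ.reg 9 ≠ 0 ↔ ∀ i' < i, ∀ k < n, ¬ bad i' k)) (by simp [Store.setReg, hn]) hB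
    ⟨rfl, rfl, fun q _ _ h => by simp [Store.setReg, h], by simp [Store.setReg]⟩ ?_
  · exact ⟨key.2.1, key.2.2.2⟩
  · rintro i hi τ ⟨hm, hb, hr, h9⟩
    have key := Cmd.run_loop_induction (O := O) (B := B) (r := 8) (e := .reg 2)
      (c := .cond e (.set 9 (.const 0)) .skip) (σ := τ.setReg 7 i)
      (fun k ρ => ρ.mem = σ.mem ∧ ρ.buf = σ.buf ∧ ρ.reg 7 = i ∧
        (∀ q, q ≠ 7 → q ≠ 8 → q ≠ 9 → ρ.reg q = σ.reg q) ∧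
        (ρ.reg 9 ≠ 0 ↔ (∀ i' < i, ∀ k < n, ¬ bad i' k) ∧ ∀ k' < k, ¬ bad i k'))
      (by simp [Store.setReg, hr, hn]) hB
      ⟨hm, hb, by simp [Store.setReg], fun q h7 h8 h9 => by simp [Store.setReg, h7, h8, h9, hr],
        by simpa [Store.setReg] using h9⟩ ?_
    · obtain ⟨h1, h2, -, h4, h5⟩ := key
      refine ⟨h1, h2, h4, h5.trans ?_⟩
      rw [Nat.forall_lt_succ_right]
    · rintro k hk ρ ⟨hm, hb, h7, hr, h9⟩
      have he' := he (ρ.setReg 8 k).reg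
        (fun q h7 h8 h9 => by simp [Store.setReg, h7, h8, h9, hr])
        (by simpa [Store.setReg, h7] using hi) (by simpa [Store.setReg] using hk)
      rw [← hm] at he'
      have e7 : (ρ.setReg 8 k).reg 7 = i := by simpa [Store.setReg] using h7
      have e8 : (ρ.setReg 8 k).reg 8 = k := by simp [Store.setReg]
      rw [e7, e8] at he'
      rw [Cmd.run_cond]
      have he'' : e.IsTrue B (ρ.setReg 8 k).reg (ρ.setReg 8 k).mem ↔ bad i k := he'
      rw [Nat.forall_lt_succ_right]
      by_cases h : bad i k
      · rw [if_pos (he''.2 h)]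
        refine ⟨hm, hb, by simpa [Cmd.run, Store.setReg] using h7, fun q q7 q8 q9 => ?_, ?_⟩
        · simp [Cmd.run, Store.setReg, q8, q9, hr q q7 q8 q9]
        · simp [Cmd.run, Store.setReg, h]
      · rw [if_neg (fun h' => h (he''.1 h'))]
        refine ⟨hm, hb, by simpa [Cmd.run, Store.setReg] using h7, fun q q7 q8 q9 => ?_, ?_⟩
        · simp [Cmd.run, Store.setReg, q8, hr q q7 q8 q9]
        · simpa [Cmd.run, Store.setReg, h] using h9

/-- Write into cell `i < reg 2` of array `2` a number `j < reg 2` such that the entry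
`(i, reg 2 + j)` of the matrix in array `1`, of size `reg 6`, is `true`, if there is one. -/
def readMap : Cmd :=
  .loop 7 (.reg 2) (.seq (.store 2 (.reg 7) (.const 0)) (.loop 8 (.reg 2)
    (.cond (.eq (.load 1 (.add (.mul (.reg 7) (.reg 6)) (.add (.reg 2) (.reg 8)))) (.const 2))
      (.store 2 (.reg 7) (.reg 8)) .skip)))

/-- `σ'` differs from `σ` at most in the registers `7` and `8` and in array `2`. -/
structure SameButMap (σ σ' : Store) : Prop where
  reg : ∀ q, q ≠ 7 → q ≠ 8 → σ'.reg q = σ.reg q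
  mem : ∀ A, A ≠ 2 → σ'.mem A = σ.mem A
  buf : σ'.buf = σ.buf

theorem SameButMap.trans {σ σ' σ'' : Store} (h : SameButMap σ σ') (h' : SameButMap σ' σ'') :
    SameButMap σ σ'' :=
  ⟨fun q h7 h8 => (h'.reg q h7 h8).trans (h.reg q h7 h8),
    fun A hA => (h'.mem A hA).trans (h.mem A hA), h'.buf.trans h.buf⟩

theorem sameButMap_setReg (σ : Store) {q : ℕ} (v : ℕ) (hq : q = 7 ∨ q = 8) :
    SameButMap σ (σ.setReg q v) :=
  ⟨fun q' h7 h8 => by simp [Store.setReg, show q' ≠ q by omega], fun _ _ => rfl, rfl⟩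

theorem sameButMap_setArray (σ : Store) (f : ℕ → ℕ) : SameButMap σ (σ.setArray 2 f) :=
  ⟨fun _ _ _ => rfl, fun A hA => by simp [Store.setArray, hA], rfl⟩

/-- Nothing is assumed about array `1`, as the oracle's answer may be meaningless. The default value
`0` keeps every entry below `n` even if a row has no suitable symbol. -/
theorem run_readMap (O : List Bool → List Bool) {B n N : ℕ} {σ : Store} (hn : σ.reg 2 = n)
    (hN : σ.reg 6 = N) (hB : n ≤ B) :
    SameButMap σ (readMap.run O B σ) ∧ ∀ i < n, (readMap.run O B σ).mem 2 i < n ∧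
      ∀ j < n, σ.mem 1 (i * N + (n + j)) = 2 →
        σ.mem 1 (i * N + (n + (readMap.run O B σ).mem 2 i)) = 2 := by
  refine Cmd.run_loop_induction (O := O) (B := B) (σ := σ) (m := n)
    (fun i τ => SameButMap σ τ ∧ ∀ i' < i, τ.mem 2 i' < n ∧
      ∀ j < n, σ.mem 1 (i' * N + (n + j)) = 2 →
        σ.mem 1 (i' * N + (n + τ.mem 2 i')) = 2) (by simp [hn]) hB
    ⟨⟨fun _ _ _ => rfl, fun _ _ => rfl, rfl⟩, by simp⟩ ?_
  rintro i hi τ ⟨hτ, hmap⟩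
  set τ' := (τ.setReg 7 i).setArray 2 (Function.update (τ.mem 2) i 0) with hτ'
  have hs : SameButMap σ τ' :=
    (hτ.trans (sameButMap_setReg τ i (Or.inl rfl))).trans (sameButMap_setArray _ _)
  have key := Cmd.run_loop_induction (O := O) (B := B) (r := 8) (e := .reg 2)
      (c := .cond (.eq (.load 1 (.add (.mul (.reg 7) (.reg 6)) (.add (.reg 2) (.reg 8))))
        (.const 2)) (.store 2 (.reg 7) (.reg 8)) .skip) (σ := τ')
      (fun k ρ => SameButMap σ ρ ∧ ρ.reg 7 = i ∧ (∀ i' < i, ρ.mem 2 i' = τ.mem 2 i') ∧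
        ρ.mem 2 i < n ∧ ∀ j < k, σ.mem 1 (i * N + (n + j)) = 2 →
        σ.mem 1 (i * N + (n + ρ.mem 2 i)) = 2)
      (by rw [Expr.eval_reg, hs.reg 2 (by omega) (by omega), hn]) hB
      ⟨hs, by simp [hτ', Store.setReg, Store.setArray], fun i' hi' => by
        simp [hτ', Store.setArray, show i' ≠ i by omega],
        by simp [hτ', Store.setArray]; omega, by simp⟩ ?_
  · have hrun : (Cmd.seq (.store 2 (.reg 7) (.const 0)) (.loop 8 (.reg 2)
        (.cond (.eq (.load 1 (.add (.mul (.reg 7) (.reg 6)) (.add (.reg 2) (.reg 8)))) (.const 2))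
          (.store 2 (.reg 7) (.reg 8)) .skip))).run O B (τ.setReg 7 i) =
        (Cmd.loop 8 (.reg 2)
        (.cond (.eq (.load 1 (.add (.mul (.reg 7) (.reg 6)) (.add (.reg 2) (.reg 8)))) (.const 2))
          (.store 2 (.reg 7) (.reg 8)) .skip)).run O B τ' := by
      rw [Cmd.run_seq]
      congr 1
    rw [hrun]
    obtain ⟨h1, -, h3, h4, h5⟩ := key
    refine ⟨h1, fun i' hi' => ?_⟩
    rcases Nat.lt_succ_iff_lt_or_eq.mp hi' with h | rfl
    · rw [h3 i' h]
      exact hmap i' h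
    · exact ⟨h4, h5⟩
  · rintro k hk ρ ⟨hρ, h7, hprev, hlt, hmap⟩
    have hρ' := hρ.trans (sameButMap_setReg ρ k (Or.inr rfl))
    have e7 : (ρ.setReg 8 k).reg 7 = i := by simpa [Store.setReg] using h7
    have e8 : (ρ.setReg 8 k).reg 8 = k := by simp [Store.setReg]
    have e2 := (hρ'.reg 2 (by omega) (by omega)).trans hn
    have e6 := (hρ'.reg 6 (by omega) (by omega)).trans hN
    have em := hρ'.mem 1 (by omega)
    rw [Cmd.run_cond]
    simp only [Expr.isTrue_eq, Expr.eval_load, Expr.eval_add, Expr.eval_mul, Expr.eval_reg,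
      Expr.eval_const, e7, e8, e2, e6, em, min_eq_left (hi.le.trans hB)]
    split_ifs with h
    · have hrun : (Cmd.store 2 (.reg 7) (.reg 8)).run O B (ρ.setReg 8 k) =
          (ρ.setReg 8 k).setArray 2 (Function.update (ρ.mem 2) i k) := by
        simp only [Cmd.run, Expr.eval_reg, e7, e8]
        rfl
      rw [hrun]
      refine ⟨hρ'.trans (sameButMap_setArray _ _), e7, fun i' hi' => ?_, ?_, ?_⟩
      · simpa [Store.setArray, show i' ≠ i by omega] using hprev i' hi'
      · simpa [Store.setArray] using hk
      · intro j _ _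
        simpa [Store.setArray] using h
    · refine ⟨hρ', e7, hprev, hlt, fun j hj hj' => ?_⟩
      rcases Nat.lt_succ_iff_lt_or_eq.mp hj with h' | rfl
      · exact hmap j h' hj'
      · exact absurd hj' h

/-- The pair in registers `7` and `8` witnesses that the map in array `2` is not an injection
that preserves adjacency and non-adjacency. -/
def mismatch : Expr :=
  let a : Expr := bit 4 (.reg 7) (.reg 8)
  let b : Expr := bit 5 (.load 2 (.reg 7)) (.load 2 (.reg 8))
  .or (.and (.not (.eq (.reg 7) (.reg 8))) (.eq (.load 2 (.reg 7)) (.load 2 (.reg 8))))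
    (.or (.and a (.not b)) (.and (.not a) b))

/-- Ask for an involution of `doubledGraph X Y`. -/
def askInvolution : Cmd :=
  .seq (.set 6 (twiceAdd 5)) (.seq (pushGraph 6 (symmetrize (doubledExpr 4 5)))
    (.seq (pushGraph 6 (symmetrize (doubledExpr 4 4))) (.seq (pushMatrix 6 exchangeExpr) (.ask 1))))

/-- The program that decides graph isomorphism with an oracle for reconstruction of involutions. -/
def isoProgram : Cmd :=
  .seq parse (.cond (.eq (.reg 2) (.reg 3))
    (.seq askInvolution (.seq readMap (.seq (checkPairs mismatch) (.push (.reg 9)))))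
    (.push (.const 0)))

theorem run_askInvolution (O : List Bool → List Bool) {B n : ℕ} {σ : Store}
    {X Y : SimpleGraph (Fin n)} (hn : σ.reg 2 = n) (hB : 2 * n + 5 ≤ B)
    (hX : HasMatrix (σ.mem 0) n (σ.reg 4) (natAdj X))
    (hY : HasMatrix (σ.mem 0) n (σ.reg 5) (natAdj Y)) (hb : σ.buf = []) :
    (askInvolution.run O B σ).buf = [] ∧ (askInvolution.run O B σ).reg 6 = 2 * n + 5 ∧
      (∀ q, 2 ≤ q → q ≠ 6 → (askInvolution.run O B σ).reg q = σ.reg q) ∧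
      (askInvolution.run O B σ).mem 0 = σ.mem 0 ∧
      (askInvolution.run O B σ).mem 1 = cells (O (graphCode (doubledGraph X Y) ++
        (graphCode (doubledGraph X X) ++ permCode (exchangePerm n)))) := by
  have hset : (Cmd.set 6 (twiceAdd 5)).run O B σ = σ.setReg 6 (2 * n + 5) := by
    simp only [Cmd.run, eval_twiceAdd hn]
  simp only [askInvolution, Cmd.run_seq, hset]
  have r1 : ∀ q, q ≠ 6 → (σ.setReg 6 (2 * n + 5)).reg q = σ.reg q := fun q hq => by
    simp [Store.setReg, hq]
  have r6 : (σ.setReg 6 (2 * n + 5)).reg 6 = 2 * n + 5 := by simp [Store.setReg]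
  have m1 : (σ.setReg 6 (2 * n + 5)).mem = σ.mem := rfl
  have b1 : (σ.setReg 6 (2 * n + 5)).buf = [] := hb
  clear hset
  generalize σ.setReg 6 (2 * n + 5) = σ₁ at *
  have n1 : σ₁.reg 2 = n := (r1 2 (by omega)).trans hn
  rw [← m1, ← r1 4 (by omega)] at hX
  rw [← m1, ← r1 5 (by omega)] at hY
  have h2 := run_pushGraph O (r := 6) (by omega) r6 hB
    (describes_doubledGraph n1 (by omega) (by omega) (by omega) hX hY)
  generalize (pushGraph 6 (symmetrize (doubledExpr 4 5))).run O B σ₁ = σ₂ at *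
  have h3 := h2.trans (run_pushGraph O (r := 6) (by omega) ((h2.reg 6 (by omega)).trans r6) hB
    ((describes_doubledGraph n1 (by omega) (by omega) (by omega) hX hX).of_extends h2))
  generalize (pushGraph 6 (symmetrize (doubledExpr 4 4))).run O B σ₂ = σ₃ at *
  have h4 := h3.trans (run_pushMatrix O (r := 6) (by omega) ((h3.reg 6 (by omega)).trans r6) hB
    ((describes_exchangePerm (B := B) n1).of_extends h3))
  generalize (pushMatrix 6 exchangeExpr).run O B σ₃ = σ₄ at *
  have hbuf : σ₄.buf = graphCode (doubledGraph X Y) ++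
      (graphCode (doubledGraph X X) ++ permCode (exchangePerm n)) := by
    rw [h4.buf, h3.buf, h2.buf, b1, List.nil_append, List.append_assoc, permCode]
  refine ⟨rfl, (h4.reg 6 (by omega)).trans r6, fun q hq h6 => (h4.reg q hq).trans (r1 q h6), ?_, ?_⟩
  · simp [Cmd.run, Store.setArray, h4.mem, m1]
  · simp [Cmd.run, Store.setArray, hbuf]

/-- The map in array `2` passes the test exactly if it is an embedding of graphs. -/
theorem run_checkPairs_mismatch (O : List Bool → List Bool) {B n : ℕ} {σ : Store}
    {X Y : SimpleGraph (Fin n)} (hn : σ.reg 2 = n) (hB : n ≤ B)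
    (hX : HasMatrix (σ.mem 0) n (σ.reg 4) (natAdj X))
    (hY : HasMatrix (σ.mem 0) n (σ.reg 5) (natAdj Y)) (hf : ∀ i < n, σ.mem 2 i < n) :
    ((checkPairs mismatch).run O B σ).buf = σ.buf ∧
      (((checkPairs mismatch).run O B σ).reg 9 ≠ 0 ↔ ∀ i < n, ∀ k < n,
        (σ.mem 2 i = σ.mem 2 k → i = k) ∧
          (natAdj X i k ↔ natAdj Y (σ.mem 2 i) (σ.mem 2 k))) := by
  have h := run_checkPairs O (B := B) (σ := σ) (e := mismatch) hn hB
    (bad := fun i k => ¬ ((σ.mem 2 i = σ.mem 2 k → i = k) ∧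
      (natAdj X i k ↔ natAdj Y (σ.mem 2 i) (σ.mem 2 k)))) ?_
  · simpa only [not_not] using h
  · intro reg hreg h7 h8
    have t2 : reg 2 = n := (hreg 2 (by omega) (by omega) (by omega)).trans hn
    rw [← hreg 4 (by omega) (by omega) (by omega)] at hX
    rw [← hreg 5 (by omega) (by omega) (by omega)] at hY
    have e1 := isTrue_bit (B := B) (a := .reg 7) (b := .reg 8) t2 hB hX h7 h8
    have e2 := isTrue_bit (B := B) (a := .load 2 (.reg 7)) (b := .load 2 (.reg 8)) t2
      hB hY (hf _ h7) (hf _ h8)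
    simp only [mismatch, Expr.isTrue_or, Expr.isTrue_and, Expr.isTrue_not, Expr.isTrue_eq,
      e1, e2, Expr.eval_load, Expr.eval_reg]
    tauto

/-- Soundness of the test: an injection of a finite vertex set into itself is bijective, so a map
that passes is an isomorphism, whatever its origin. -/
theorem nonempty_iso_of_map {n : ℕ} {X Y : SimpleGraph (Fin n)} {f : ℕ → ℕ}
    (hf : ∀ i < n, f i < n)
    (h : ∀ i < n, ∀ k < n, (f i = f k → i = k) ∧ (natAdj X i k ↔ natAdj Y (f i) (f k))) :
    Nonempty (X ≃g Y) := by
  let g : Fin n → Fin n := fun i => ⟨f i, hf i i.isLt⟩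
  have ginj : Function.Injective g := fun i k hik =>
    Fin.ext ((h i i.isLt k k.isLt).1 (congrArg Fin.val hik))
  refine ⟨⟨Equiv.ofBijective g (Finite.injective_iff_bijective.1 ginj), fun {i k} => ?_⟩⟩
  change Y.Adj (g i) (g k) ↔ X.Adj i k
  rw [← natAdj_val X, ← natAdj_val Y]
  exact (h i i.isLt k k.isLt).2.symm

/-- The map that is read off from a fixed-edge-free involution is an embedding. -/
theorem map_of_involution {n : ℕ} {X Y : SimpleGraph (Fin n)} {α : Equiv.Perm (Fin (2 * n + 5))}
    (hα : IsFixedEdgeFreeInvolution (doubledGraph X Y) α) {f : ℕ → ℕ}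
    (hf : ∀ i < n, f i < n ∧ ∀ j < n, cells (permCode α) (i * (2 * n + 5) + (n + j)) = 2 →
      cells (permCode α) (i * (2 * n + 5) + (n + f i)) = 2)
    (i : ℕ) (hi : i < n) (k : ℕ) (hk : k < n) :
    (f i = f k → i = k) ∧ (natAdj X i k ↔ natAdj Y (f i) (f k)) := by
  -- The involution sends `v` into the second half, so row `v` of its matrix has a `true` entry in
  -- the window that was searched; a row of a permutation matrix has only one, so `f v` locates it.
  have hval : ∀ v, ∀ hv : v < n, (α ⟨v, by omega⟩).val = n + f v := by
    intro v hv
    obtain ⟨g1, g2⟩ := exchanges_of_involution hα ⟨v, by omega⟩ hv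
    obtain ⟨fl, hfv⟩ := hf v hv
    have c := fun j (hj : n + j < 2 * n + 5) =>
      cells_matrixBits (fun a b => α a = b) ⟨v, by omega⟩ ⟨n + j, hj⟩
    have h1 := hfv ((α ⟨v, by omega⟩).val - n) (by omega) ((c _ (by omega)).2
      (Fin.ext (show (α ⟨v, by omega⟩).val = n + ((α ⟨v, by omega⟩).val - n) by omega)))
    exact congrArg Fin.val ((c _ (by omega)).1 h1)
  have hadj := adj_iff_of_involution hα ⟨i, by omega⟩ ⟨k, by omega⟩ hi hk
  rw [hval i hi, hval k hk, Nat.add_sub_cancel_left, Nat.add_sub_cancel_left] at hadj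
  refine ⟨fun he => ?_, hadj.symm⟩
  have : α ⟨i, by omega⟩ = α ⟨k, by omega⟩ := Fin.ext (by rw [hval i hi, hval k hk, he])
  exact congrArg Fin.val (α.injective this)

theorem isAnswer_isoProgram (O : List Bool → List Bool) (hO : PAR.SolvedBy O) (I : GIInstance) :
    GI.IsAnswer I
      (isoProgram.run O ((GI.encode I).length + 8) (initStore (GI.encode I))).buf := by
  classical
  obtain ⟨n, m, X, Y⟩ := I
  change _ = [decide (Nonempty (X ≃g Y))]
  have hx : GI.encode ⟨n, m, X, Y⟩ = graphCode X ++ (graphCode Y ++ []) := by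
    simp [GI, GIInstance.encode]
  rw [hx]
  have hlen : (graphCode X ++ (graphCode Y ++ [])).length =
      n + 1 + n * n + (m + 1 + m * m) := by simp [graphCode_length]
  obtain ⟨B, hB⟩ : ∃ B, (graphCode X ++ (graphCode Y ++ [])).length + 8 = B := ⟨_, rfl⟩
  rw [hB]
  obtain ⟨reg, hparse, r2, r3, r4, r5, -⟩ := run_parse O X Y [] (B := B) (by omega) (by omega)
  simp only [isoProgram, Cmd.run_seq, hparse, Cmd.run_cond, Expr.isTrue_eq, Expr.eval_reg]
  have h0 : (initStore (graphCode X ++ (graphCode Y ++ []))).mem 0 =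
    cells (graphCode X ++ (graphCode Y ++ [])) := by simp [initStore]
  generalize (initStore (graphCode X ++ (graphCode Y ++ []))).mem = mem at *
  by_cases hnm : n = m
  · subst hnm
    have hX : HasMatrix (mem 0) n (reg 4) (natAdj X) := by
      rw [h0, r4]
      exact hasMatrix_graphCode X _
    have hY : HasMatrix (mem 0) n (reg 5) (natAdj Y) := by
      rw [h0, r5, ← graphCode_length X]
      exact (hasMatrix_graphCode Y []).append (graphCode X)
    rw [if_pos (r2.trans r3.symm)]
    have hB' : 2 * n + 5 ≤ B := by omega
    obtain ⟨b₁, q6, q, m0, m1⟩ := run_askInvolution O (σ := ⟨reg, mem, []⟩) r2 hB' hX hY rfl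
    generalize askInvolution.run O B ⟨reg, mem, []⟩ = σ₁ at *
    obtain ⟨hs, hmap⟩ := run_readMap O (σ := σ₁) (B := B) ((q 2 (by omega) (by omega)).trans r2) q6
      (by omega)
    generalize readMap.run O B σ₁ = σ₂ at *
    have s0 : σ₂.mem 0 = mem 0 := (hs.mem 0 (by omega)).trans m0
    have hreg : ∀ q, 2 ≤ q → q ≠ 6 → q ≠ 7 → q ≠ 8 → σ₂.reg q = reg q := fun r h2 h6 h7 h8 =>
      (hs.reg r h7 h8).trans (q r h2 h6)
    rw [← s0, ← hreg 4 (by omega) (by omega) (by omega) (by omega)] at hX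
    rw [← s0, ← hreg 5 (by omega) (by omega) (by omega) (by omega)] at hY
    obtain ⟨b₃, hcheck⟩ := run_checkPairs_mismatch O (B := B) (σ := σ₂)
      ((hreg 2 (by omega) (by omega) (by omega) (by omega)).trans r2) (by omega) hX hY
      (fun i hi => (hmap i hi).1)
    generalize (checkPairs mismatch).run O B σ₂ = σ₃ at *
    rw [Cmd.run_push]
    simp only [b₃, hs.buf, b₁, List.nil_append, List.cons.injEq, and_true, decide_eq_decide]
    -- Acceptance implies isomorphism without any knowledge about the oracle's answer; the oracle
    -- matters only for the converse.
    refine hcheck.trans ⟨nonempty_iso_of_map fun i hi => (hmap i hi).1, ?_⟩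
    rintro ⟨ψ⟩
    -- Under the assumption `X ≃g Y` the query is a genuine instance, so its answer is the matrix of
    -- a fixed-edge-free involution.
    obtain ⟨φ⟩ := doubledGraph_iso (X := X) ψ
    obtain ⟨α, hα, hans⟩ := hO (⟨2 * n + 5, doubledGraph X Y, doubledGraph X X, exchangePerm n,
      ⟨φ.symm⟩, exchangePerm_involution X⟩ : PARInstance)
    have hm1 : σ₁.mem 1 = cells (permCode α) := by
      rw [m1, ← hans]
      rfl
    rw [hm1] at hmap
    exact map_of_involution hα hmap
  · rw [if_neg (by rwa [r2, r3])]
    have : ¬ Nonempty (X ≃g Y) := by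
      rintro ⟨φ⟩
      exact hnm (by simpa using Fintype.card_congr φ.toEquiv)
    simp [Cmd.run, this]

theorem gi_reducible_par : PolyTimeTuringReducible GI PAR :=
  reducible_of_run isoProgram isAnswer_isoProgram

end StructuredRAM

/-- This supplies the assumption `2 ≤ n` under which labels can be recovered from labelled graphs.
-/
theorem IsFixedEdgeFreeInvolution.two_le {n : ℕ} {G : SimpleGraph (Fin n)}
    {β : Equiv.Perm (Fin n)} (h : IsFixedEdgeFreeInvolution G β) : 2 ≤ n := by
  by_contra hn
  have : Subsingleton (Fin n) := Fin.subsingleton_iff_le_one.2 (by omega)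
  have h1 : β = 1 := Subsingleton.elim _ _
  have := h.2.1
  simp [h1] at this

namespace StructuredRAM

open OracleRAM

/-! ### Finding an isomorphism with an oracle for graph isomorphism -/

/-- Give the vertex `reg 8` of `H` the label `reg 7` and ask whether the labelled graphs are
isomorphic. If so, set register `9` to `1`; otherwise, remove the label. -/
def tryLabel : Cmd :=
  .seq (.store 2 (.reg 8) (.reg 7)) (.seq (pushGraph 6 (symmetrize (labelExpr 4 1)))
    (.seq (pushGraph 6 (symmetrize (labelExpr 5 2))) (.seq (.ask 3)
    (.cond (.eq (.load 3 (.const 0)) (.const 2)) (.set 9 (.const 1))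
      (.store 2 (.reg 8) (.reg 2))))))

/-- Label the vertex `reg 7` of `G` by its number, and find a vertex of `H` to match. -/
def matchVertex : Cmd :=
  .seq (.store 1 (.reg 7) (.reg 7)) (.seq (.set 9 (.const 0)) (.loop 8 (.reg 2)
    (.cond (.and (.eq (.reg 9) (.const 0)) (.eq (.load 2 (.reg 8)) (.reg 2))) tryLabel .skip)))

/-- Remove all labels; the absence of a label is represented by the number of vertices. -/
def clearLabels : Cmd :=
  .loop 7 (.reg 2) (.seq (.store 1 (.reg 7) (.reg 2)) (.store 2 (.reg 7) (.reg 2)))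

/-- Invert the permutation in array `2`; the inverse is written into array `4`. -/
def invertLabels : Cmd := .loop 7 (.reg 2) (.store 4 (.load 2 (.reg 7)) (.reg 7))

/-- The program that reconstructs an involution with an oracle for graph isomorphism. -/
def involutionProgram : Cmd :=
  .seq parse (.seq (.set 6 (twiceAdd 3)) (.seq (.set 11 (.add (.reg 10) (.reg 10)))
    (.seq clearLabels (.seq (.loop 7 (.reg 2) matchVertex) (.seq invertLabels
    (pushMatrix 2 (bit 11 (.load 4 (.reg 0)) (.load 4 (.reg 1)))))))))

/-- The part of the store that is constant during the search. -/
structure SearchContext (n : ℕ) (G H : SimpleGraph (Fin n)) (R : Fin n → Fin n → Prop)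
    (σ : Store) : Prop where
  size : σ.reg 2 = n
  size' : σ.reg 6 = 2 * n + 3
  left : HasMatrix (σ.mem 0) n (σ.reg 4) (natAdj G)
  right : HasMatrix (σ.mem 0) n (σ.reg 5) (natAdj H)
  perm : ∀ i j : Fin n, σ.mem 0 (σ.reg 11 + (i * n + j)) = 2 ↔ R i j
  buf : σ.buf = []

theorem SearchContext.congr {n : ℕ} {G H : SimpleGraph (Fin n)} {R : Fin n → Fin n → Prop}
    {σ σ' : Store} (h : SearchContext n G H R σ)
    (hr : ∀ q, q = 2 ∨ q = 4 ∨ q = 5 ∨ q = 6 ∨ q = 11 → σ'.reg q = σ.reg q)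
    (hm : σ'.mem 0 = σ.mem 0) (hb : σ'.buf = []) : SearchContext n G H R σ' where
  size := by rw [hr 2 (by omega), h.size]
  size' := by rw [hr 6 (by omega), h.size']
  left := by rw [hr 4 (by omega), hm]; exact h.left
  right := by rw [hr 5 (by omega), hm]; exact h.right
  perm := by rw [hr 11 (by omega), hm]; exact h.perm
  buf := hb

theorem SearchContext.setReg {n : ℕ} {G H : SimpleGraph (Fin n)} {R : Fin n → Fin n → Prop}
    {σ : Store} (h : SearchContext n G H R σ) {q : ℕ} (v : ℕ) (hq : q = 7 ∨ q = 8 ∨ q = 9) :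
    SearchContext n G H R (σ.setReg q v) :=
  h.congr (fun q' hq' => by simp [Store.setReg, show q' ≠ q by omega]) rfl h.buf

theorem SearchContext.setArray {n : ℕ} {G H : SimpleGraph (Fin n)} {R : Fin n → Fin n → Prop}
    {σ : Store} (h : SearchContext n G H R σ) {A : ℕ} (f : ℕ → ℕ) (hA : A ≠ 0) :
    SearchContext n G H R (σ.setArray A f) :=
  h.congr (fun _ _ => rfl) (by simp [Store.setArray, hA.symm]) h.buf

/-- There is an isomorphism compatible with the labels. -/
def LabelIso {n : ℕ} (G H : SimpleGraph (Fin n)) (pos pos' : ℕ → ℕ) : Prop :=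
  ∃ ψ : G ≃g H, ∀ v : Fin n, pos' (ψ v) = pos v

/-- This translates the oracle's verdict on two uncoloured graphs into a statement about labelled
ones. -/
theorem nonempty_labelledGraph_iso_iff {n : ℕ} (hn : 2 ≤ n) {G H : SimpleGraph (Fin n)}
    {pos pos' : ℕ → ℕ} (hpos : ∀ v < n, pos v ≤ n) (hpos' : ∀ v < n, pos' v ≤ n) :
    Nonempty (labelledGraph G pos ≃g labelledGraph H pos') ↔ LabelIso G H pos pos' :=
  ⟨fun ⟨φ⟩ => exists_iso_of_labelledGraph_iso hn hpos hpos' φ,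
    fun ⟨ψ, h⟩ => labelledGraph_iso_of_iso ψ h⟩

theorem run_tryLabel {O : List Bool → List Bool} (hO : GI.SolvedBy O) {B n : ℕ} (hn : 2 ≤ n)
    (hB : 2 * n + 3 ≤ B) {G H : SimpleGraph (Fin n)} {R : Fin n → Fin n → Prop} {σ : Store}
    (hσ : SearchContext n G H R σ) (h1 : ∀ v < n, σ.mem 1 v ≤ n) (h2 : ∀ v < n, σ.mem 2 v ≤ n)
    {j k : ℕ} (h7 : σ.reg 7 = k) (h8 : σ.reg 8 = j) (hk : k < n) (h2j : σ.mem 2 j = n) :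
    SearchContext n G H R (tryLabel.run O B σ) ∧ (tryLabel.run O B σ).reg 7 = k ∧
      (tryLabel.run O B σ).mem 1 = σ.mem 1 ∧
      ((LabelIso G H (σ.mem 1) (Function.update (σ.mem 2) j k) ∧ (tryLabel.run O B σ).reg 9 = 1 ∧
          (tryLabel.run O B σ).mem 2 = Function.update (σ.mem 2) j k) ∨
        (¬ LabelIso G H (σ.mem 1) (Function.update (σ.mem 2) j k) ∧
          (tryLabel.run O B σ).reg 9 = σ.reg 9 ∧ (tryLabel.run O B σ).mem 2 = σ.mem 2)) := by
  classical
  set pos' := Function.update (σ.mem 2) j k with hpos'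
  have hpos'n : ∀ v < n, pos' v ≤ n := by
    intro v hv
    rw [hpos', Function.update_apply]
    split_ifs
    · exact hk.le
    · exact h2 v hv
  have hst : (Cmd.store 2 (.reg 8) (.reg 7)).run O B σ = σ.setArray 2 pos' := by
    simp [Cmd.run, h7, h8, hpos']
  have c1 := hσ.setArray pos' (A := 2) (by omega)
  have p1 : (σ.setArray 2 pos').mem 1 = σ.mem 1 := by simp [Store.setArray]
  have p2 : (σ.setArray 2 pos').mem 2 = pos' := by simp [Store.setArray]
  have r1 : (σ.setArray 2 pos').reg = σ.reg := rfl
  simp only [tryLabel, Cmd.run_seq, hst]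
  generalize σ.setArray 2 pos' = σ₁ at *
  have hd1 := describes_labelledGraph (B := B) (A := 1) c1.size (by omega) (by omega) c1.left
  have hd2 := describes_labelledGraph (B := B) (A := 2) c1.size (by omega) (by omega) c1.right
  have e2 := run_pushGraph O (r := 6) (by omega) c1.size' hB hd1
  generalize (pushGraph 6 (symmetrize (labelExpr 4 1))).run O B σ₁ = σ₂ at *
  have e3 := e2.trans (run_pushGraph O (r := 6) (by omega) ((e2.reg 6 (by omega)).trans c1.size') hB
    (hd2.of_extends e2))
  generalize (pushGraph 6 (symmetrize (labelExpr 5 2))).run O B σ₂ = σ₃ at *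
  rw [p2, e2.buf, c1.buf, List.nil_append, p1] at e3
  have hans : O σ₃.buf = [decide (LabelIso G H (σ.mem 1) pos')] := by
    have := hO (⟨_, _, labelledGraph G (σ.mem 1), labelledGraph H pos'⟩ : GIInstance)
    rw [e3.buf]
    refine Eq.trans this ?_
    simp only [nonempty_labelledGraph_iso_iff hn h1 hpos'n]
  have hask : (Cmd.ask 3).run O B σ₃ = ⟨σ₃.reg, Function.update σ₃.mem 3
      (cells [decide (LabelIso G H (σ.mem 1) pos')]), []⟩ := by
    simp [Cmd.run, Store.setArray, hans]
  rw [hask]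
  have m3 : σ₃.mem = σ₁.mem := e3.mem
  have c4 : SearchContext n G H R ⟨σ₃.reg, Function.update σ₃.mem 3
      (cells [decide (LabelIso G H (σ.mem 1) pos')]), []⟩ :=
    c1.congr (fun q hq => e3.reg q (by omega)) (by simp [m3]) rfl
  have g7 : σ₃.reg 7 = k := by rw [e3.reg 7 (by omega), r1, h7]
  have g8 : σ₃.reg 8 = j := by rw [e3.reg 8 (by omega), r1, h8]
  have g9 : σ₃.reg 9 = σ.reg 9 := by rw [e3.reg 9 (by omega), r1]
  have g2 : σ₃.reg 2 = n := by rw [e3.reg 2 (by omega), c1.size]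
  rw [Cmd.run_cond]
  by_cases hiso : LabelIso G H (σ.mem 1) pos'
  · rw [if_pos (by simp [hiso, cells])]
    refine ⟨c4.setReg 1 (q := 9) (by omega), ?_, ?_, Or.inl ⟨hiso, ?_, ?_⟩⟩
    · simpa [Cmd.run, Store.setReg] using g7
    · simpa [Cmd.run, Store.setReg, m3] using p1
    · simp [Cmd.run, Store.setReg]
    · simpa [Cmd.run, Store.setReg, m3] using p2
  · rw [if_neg (by simp [hiso, cells])]
    refine ⟨c4.setArray (A := 2) _ (by omega), ?_, ?_, Or.inr ⟨hiso, ?_, ?_⟩⟩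
    · simpa [Cmd.run, Store.setArray] using g7
    · simpa [Cmd.run, Store.setArray, m3] using p1
    · simpa [Cmd.run, Store.setArray] using g9
    -- Removing the label writes `n`; by `h2j` this was the former value, so the array is restored.
    · simp [Cmd.run, Store.setArray, m3, p2, g8, g2, hpos', h2j]

/-- The invariant of the search: some isomorphism respects the labels given so far. It need not be
the same one before and after, since any candidate accepted by the oracle is kept. -/
theorem run_matchVertex {O : List Bool → List Bool} (hO : GI.SolvedBy O) {B n : ℕ} (hn : 2 ≤ n)
    (hB : 2 * n + 3 ≤ B) {G H : SimpleGraph (Fin n)} {R : Fin n → Fin n → Prop} {σ : Store}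
    (hσ : SearchContext n G H R σ) {k : ℕ} (h7 : σ.reg 7 = k) (hk : k < n)
    (h1 : ∀ v < n, σ.mem 1 v = if v < k then v else n)
    (h2 : LabelIso G H (σ.mem 1) (σ.mem 2)) :
    SearchContext n G H R (matchVertex.run O B σ) ∧
      (∀ v < n, (matchVertex.run O B σ).mem 1 v = if v < k + 1 then v else n) ∧
      LabelIso G H ((matchVertex.run O B σ).mem 1) ((matchVertex.run O B σ).mem 2) := by
  set pos := Function.update (σ.mem 1) k k with hpos
  have hst : (Cmd.set 9 (.const 0)).run O B ((Cmd.store 1 (.reg 7) (.reg 7)).run O B σ) =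
      (σ.setArray 1 pos).setReg 9 0 := by
    simp [Cmd.run, h7, hpos]
  have hposk : ∀ v < n, pos v = if v < k + 1 then v else n := by
    intro v hv
    rw [hpos, Function.update_apply]
    by_cases hvk : v = k
    · simp [hvk]
    · rw [if_neg hvk, h1 v hv]
      congr 1
      simp; omega
  have hposn : ∀ v < n, pos v ≤ n := by
    intro v hv
    rw [hposk v hv]
    split_ifs <;> omega
  obtain ⟨ψ, hψ⟩ := h2
  have h2n : ∀ v < n, σ.mem 2 v ≤ n := by
    intro v hv
    have := hψ (ψ.symm ⟨v, hv⟩)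
    rw [ψ.apply_symm_apply] at this
    simp only at this
    rw [this, h1 _ (ψ.symm ⟨v, hv⟩).isLt]
    split_ifs <;> omega
  -- Some candidate must succeed: the image of `k` under the compatible `ψ` is still unlabelled, and
  -- `ψ` remains compatible when both vertices receive the label `k`.
  have hex : σ.mem 2 (ψ ⟨k, hk⟩) = n ∧
      LabelIso G H pos (Function.update (σ.mem 2) (ψ ⟨k, hk⟩) k) := by
    refine ⟨?_, ψ, fun v => ?_⟩
    · rw [hψ, h1 _ hk]
      simp
    · by_cases hvk : v = ⟨k, hk⟩
      · subst hvk
        simp [hpos]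
      · have n1 : (ψ v).val ≠ ψ ⟨k, hk⟩ := fun e => hvk (ψ.injective (Fin.ext e))
        have n2 : v.val ≠ k := fun e => hvk (Fin.ext e)
        rw [Function.update_of_ne n1, hpos, Function.update_of_ne n2, hψ]
  have c1 : SearchContext n G H R ((σ.setArray 1 pos).setReg 9 0) :=
    (hσ.setArray pos (by omega)).setReg 0 (by omega)
  have s1 : ((σ.setArray 1 pos).setReg 9 0).mem 1 = pos := by simp [Store.setReg, Store.setArray]
  have s2 : ((σ.setArray 1 pos).setReg 9 0).mem 2 = σ.mem 2 := by
    simp [Store.setReg, Store.setArray]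
  have s7 : ((σ.setArray 1 pos).setReg 9 0).reg 7 = k := by
    simpa [Store.setReg, Store.setArray] using h7
  have s9 : ((σ.setArray 1 pos).setReg 9 0).reg 9 = 0 := by simp [Store.setReg]
  simp only [matchVertex, Cmd.run_seq, hst]
  generalize (σ.setArray 1 pos).setReg 9 0 = σ₁ at *
  -- Either a match has been found, or the labels on `H` are untouched and all unlabelled candidates
  -- below `j` have been refuted. The second case cannot persist to the end, by `hex`.
  have key := Cmd.run_loop_induction (O := O) (B := B) (r := 8) (e := .reg 2)
    (c := .cond (.and (.eq (.reg 9) (.const 0)) (.eq (.load 2 (.reg 8)) (.reg 2))) tryLabel .skip)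
    (σ := σ₁) (fun j τ => SearchContext n G H R τ ∧ τ.reg 7 = k ∧ τ.mem 1 = pos ∧
      ((τ.reg 9 = 1 ∧ LabelIso G H pos (τ.mem 2)) ∨
        (τ.reg 9 = 0 ∧ τ.mem 2 = σ.mem 2 ∧ ∀ i < j, σ.mem 2 i = n →
          ¬ LabelIso G H pos (Function.update (σ.mem 2) i k)))) c1.size (by omega)
    ⟨c1, s7, s1, Or.inr ⟨s9, s2, by simp⟩⟩ ?_
  · obtain ⟨c2, -, t1, ht⟩ := key
    rw [t1]
    refine ⟨c2, hposk, ?_⟩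
    rcases ht with ⟨-, ht⟩ | ⟨-, -, ht⟩
    · exact ht
    · exact absurd hex.2 (ht _ (ψ ⟨k, hk⟩).isLt hex.1)
  · rintro j hj τ ⟨c, t7, t1, ht⟩
    have c' := c.setReg j (q := 8) (by omega)
    have u7 : (τ.setReg 8 j).reg 7 = k := by simpa [Store.setReg] using t7
    have u9 : (τ.setReg 8 j).reg 9 = τ.reg 9 := by simp [Store.setReg]
    have u8 : (τ.setReg 8 j).reg 8 = j := by simp [Store.setReg]
    have um : (τ.setReg 8 j).mem = τ.mem := rfl
    generalize τ.setReg 8 j = τ' at *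
    rw [Cmd.run_cond]
    simp only [Expr.isTrue_and, Expr.isTrue_eq, Expr.eval_reg, Expr.eval_const, Expr.eval_load,
      u8, u9, c'.size, um]
    rcases ht with ⟨t9, ht⟩ | ⟨t9, t2, ht⟩
    · rw [if_neg (by simp [t9])]
      exact ⟨c', u7, by rw [Cmd.run, um, t1], Or.inl ⟨by rw [Cmd.run, u9, t9],
        by rwa [Cmd.run, um]⟩⟩
    · by_cases hj2 : σ.mem 2 j = n
      · rw [if_pos ⟨t9, by rw [t2, hj2]⟩]
        obtain ⟨d1, d2, d3, d4⟩ := run_tryLabel hO hn hB c' (by rwa [um, t1]) (by rwa [um, t2]) u7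
          u8 hk (by rw [um, t2, hj2])
        rw [um, t2, t1] at d4
        refine ⟨d1, d2, by rw [d3, um, t1], ?_⟩
        rcases d4 with ⟨i1, i2, i3⟩ | ⟨i1, i2, i3⟩
        · exact Or.inl ⟨i2, by rwa [i3]⟩
        · refine Or.inr ⟨by rw [i2, u9, t9], i3, fun i hi hin => ?_⟩
          rcases Nat.lt_succ_iff_lt_or_eq.mp hi with h | rfl
          · exact ht i h hin
          · exact i1
      · rw [if_neg (by rw [t2]; tauto)]
        refine ⟨c', u7, by rw [Cmd.run, um, t1], Or.inr ⟨by rw [Cmd.run, u9, t9],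
          by rw [Cmd.run, um, t2], fun i hi hin => ?_⟩⟩
        rcases Nat.lt_succ_iff_lt_or_eq.mp hi with h | rfl
        · exact ht i h hin
        · exact absurd hin hj2

theorem run_clearLabels (O : List Bool → List Bool) {B n : ℕ} (hB : n ≤ B)
    {G H : SimpleGraph (Fin n)} {R : Fin n → Fin n → Prop} {σ : Store}
    (hσ : SearchContext n G H R σ) :
    SearchContext n G H R (clearLabels.run O B σ) ∧
      ∀ v < n, (clearLabels.run O B σ).mem 1 v = n ∧ (clearLabels.run O B σ).mem 2 v = n := by
  refine Cmd.run_loop_induction (O := O) (B := B) (σ := σ) (m := n)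
    (fun i τ => SearchContext n G H R τ ∧ ∀ v < i, τ.mem 1 v = n ∧ τ.mem 2 v = n)
    hσ.size hB ⟨hσ, by simp⟩ ?_
  rintro i hi τ ⟨c, h⟩
  have hrun : (Cmd.seq (.store 1 (.reg 7) (.reg 2)) (.store 2 (.reg 7) (.reg 2))).run O B
      (τ.setReg 7 i) = ((τ.setReg 7 i).setArray 1 (Function.update (τ.mem 1) i n)).setArray 2
        (Function.update (τ.mem 2) i n) := by
    simp [Cmd.run, Store.setReg, Store.setArray, c.size]
  rw [hrun]
  refine ⟨((c.setReg i (by omega)).setArray _ (by omega)).setArray _ (by omega), fun v hv => ?_⟩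
  by_cases hvi : v = i
  · simp [Store.setArray, hvi]
  · simpa [Store.setArray, hvi, Function.update_apply] using h v (by omega)

/-- Array `2` stores `φ⁻¹`, as the vertex `φ v` carries the label `v`. Round `i` fills in the
preimage of `i`, so after `i` rounds all `v` with `φ v < i` are done. -/
theorem run_invertLabels (O : List Bool → List Bool) {B n : ℕ} (hB : n ≤ B)
    {G H : SimpleGraph (Fin n)} {R : Fin n → Fin n → Prop} {σ : Store}
    (hσ : SearchContext n G H R σ) (φ : Equiv.Perm (Fin n))
    (hφ : ∀ v : Fin n, σ.mem 2 (φ v) = v) :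
    SearchContext n G H R (invertLabels.run O B σ) ∧
      ∀ v : Fin n, (invertLabels.run O B σ).mem 4 v = φ v := by
  have key := Cmd.run_loop_induction (O := O) (B := B) (r := 7) (e := .reg 2)
    (c := .store 4 (.load 2 (.reg 7)) (.reg 7)) (σ := σ)
    (fun i τ => SearchContext n G H R τ ∧ τ.mem 2 = σ.mem 2 ∧
      ∀ v : Fin n, (φ v).val < i → τ.mem 4 v = φ v) hσ.size hB ⟨hσ, rfl, by simp⟩ ?_
  · exact ⟨key.1, fun v => key.2.2 v (φ v).isLt⟩
  · rintro i hi τ ⟨c, h2, h⟩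
    have hrun : (Cmd.store 4 (.load 2 (.reg 7)) (.reg 7)).run O B (τ.setReg 7 i) =
        (τ.setReg 7 i).setArray 4 (Function.update (τ.mem 4) (σ.mem 2 i) i) := by
      simp [Cmd.run, Store.setReg, h2]
    rw [hrun]
    refine ⟨(c.setReg i (by omega)).setArray _ (by omega), by
      simpa [Store.setArray, Store.setReg] using h2, fun v hv => ?_⟩
    have hi' : σ.mem 2 i = φ.symm ⟨i, hi⟩ := by
      have := hφ (φ.symm ⟨i, hi⟩)
      rwa [φ.apply_symm_apply] at this
    rw [hi']
    by_cases hvi : (φ v).val = i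
    · obtain rfl : v = φ.symm ⟨i, hi⟩ := by
        rw [Equiv.eq_symm_apply]
        exact Fin.ext hvi
      simp [Store.setArray]
    · have hne : v.val ≠ (φ.symm ⟨i, hi⟩).val := by
        intro e
        apply hvi
        rw [Fin.ext e, φ.apply_symm_apply]
      simpa [Store.setArray, Function.update_of_ne hne] using h v (by omega)

theorem isAnswer_involutionProgram (O : List Bool → List Bool) (hO : GI.SolvedBy O)
    (I : PARInstance) : PAR.IsAnswer I
      (involutionProgram.run O ((PAR.encode I).length + 8) (initStore (PAR.encode I))).buf := by
  obtain ⟨n, G, H, β, ⟨φ₀⟩, hβ⟩ := I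
  change ∃ α : Equiv.Perm (Fin n), IsFixedEdgeFreeInvolution G α ∧ _ = permCode α
  have hn : 2 ≤ n := hβ.two_le
  change ∃ α : Equiv.Perm (Fin n), IsFixedEdgeFreeInvolution G α ∧
    (involutionProgram.run O ((graphCode G ++ (graphCode H ++ permCode β)).length + 8)
      (initStore (graphCode G ++ (graphCode H ++ permCode β)))).buf = permCode α
  have hlen : (graphCode G ++ (graphCode H ++ permCode β)).length =
      n + 1 + n * n + (n + 1 + n * n + n * n) := by
    simp [graphCode_length, permCode, matrixBits_length]
  obtain ⟨B, hB⟩ : ∃ B, (graphCode G ++ (graphCode H ++ permCode β)).length + 8 = B := ⟨_, rfl⟩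
  rw [hB]
  have hB3 : 2 * n + 3 ≤ B := by omega
  obtain ⟨reg, hparse, r2, -, r4, r5, r10⟩ :=
    run_parse O G H (permCode β) (B := B) (by omega) (by omega)
  simp only [involutionProgram, Cmd.run_seq, hparse]
  have h0 : (initStore (graphCode G ++ (graphCode H ++ permCode β))).mem 0 =
    cells (graphCode G ++ (graphCode H ++ permCode β)) := by simp [initStore]
  generalize (initStore (graphCode G ++ (graphCode H ++ permCode β))).mem = mem at *
  have hset : (Cmd.set 11 (.add (.reg 10) (.reg 10))).run O B
      ((Cmd.set 6 (twiceAdd 3)).run O B ⟨reg, mem, []⟩) =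
      ((⟨reg, mem, []⟩ : Store).setReg 6 (2 * n + 3)).setReg 11
        (n + 1 + n * n + (n + 1 + n * n)) := by
    simp [Cmd.run, Store.setReg, eval_twiceAdd r2, r10]
  rw [hset]
  have c1 : SearchContext n G H (fun i j => β i = j)
      (((⟨reg, mem, []⟩ : Store).setReg 6 (2 * n + 3)).setReg 11
        (n + 1 + n * n + (n + 1 + n * n))) := by
    refine ⟨?_, ?_, ?_, ?_, fun i j => ?_, rfl⟩
    · simpa [Store.setReg] using r2
    · simp [Store.setReg]
    · simp only [Store.setReg, h0]
      rw [Function.update_of_ne (by decide), Function.update_of_ne (by decide), r4]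
      exact hasMatrix_graphCode G _
    · simp only [Store.setReg, h0]
      rw [Function.update_of_ne (by decide), Function.update_of_ne (by decide), r5,
        ← graphCode_length G]
      exact (hasMatrix_graphCode H _).append (graphCode G)
    · simp only [Store.setReg, h0, Function.update_self]
      -- The matrix of `β` follows two graph codes, which have equal length since `G` and `H` have
      -- the same number of vertices.
      rw [add_assoc (n + 1 + n * n)]
      nth_rewrite 1 [← graphCode_length G]
      rw [cells_append_add, ← graphCode_length H, cells_append_add]
      exact cells_matrixBits _ i j
  generalize ((⟨reg, mem, []⟩ : Store).setReg 6 (2 * n + 3)).setReg 11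
    (n + 1 + n * n + (n + 1 + n * n)) = σ₁ at *
  obtain ⟨c2, hclear⟩ := run_clearLabels O (B := B) (by omega) c1
  generalize clearLabels.run O B σ₁ = σ₂ at *
  have hsearch := Cmd.run_loop_induction (O := O) (B := B) (r := 7) (e := .reg 2)
    (c := matchVertex) (σ := σ₂) (fun k τ => SearchContext n G H (fun i j => β i = j) τ ∧
      (∀ v < n, τ.mem 1 v = if v < k then v else n) ∧ LabelIso G H (τ.mem 1) (τ.mem 2))
    c2.size (by omega)
    -- Before the search all labels equal `n`, and any isomorphism `φ₀` is compatible with constant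
    -- labels.
    ⟨c2, fun v hv => by simpa using (hclear v hv).1, φ₀, fun v => by
      rw [(hclear v v.isLt).1, (hclear _ (φ₀ v).isLt).2]⟩
    (by
      rintro k hk τ ⟨c, hτ1, hτ2⟩
      exact run_matchVertex hO hn hB3 (c.setReg k (by omega)) (by simp [Store.setReg]) hk hτ1 hτ2)
  generalize (Cmd.loop 7 (.reg 2) matchVertex).run O B σ₂ = σ₃ at *
  obtain ⟨c3, hlab, φ, hφ⟩ := hsearch
  -- After `n` rounds the labels on `G` are the distinct numbers below `n`, so the labels on `H`
  -- determine `φ` completely.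
  obtain ⟨c4, hinv⟩ := run_invertLabels O (B := B) (by omega) c3 φ.toEquiv (fun v => by
    have := hφ v
    rwa [hlab v v.isLt, if_pos v.isLt] at this)
  generalize invertLabels.run O B σ₃ = σ₄ at *
  refine ⟨φ.toEquiv.symm.permCongr β, hβ.conj φ, ?_⟩
  have hout := run_pushMatrix O (B := B) (r := 2) (σ := σ₄)
    (e := bit 11 (.load 4 (.reg 0)) (.load 4 (.reg 1))) le_rfl c4.size (by omega)
    (R := fun i j => φ.toEquiv.symm.permCongr β i = j) ?_
  · rw [hout.buf, c4.buf, List.nil_append]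
    rfl
  · intro reg' hreg i j hi hj
    have e0 : (Expr.load 4 (.reg 0)).eval B reg' σ₄.mem = φ i := by
      rw [Expr.eval_load, Expr.eval_reg, hi, hinv]; rfl
    have e1 : (Expr.load 4 (.reg 1)).eval B reg' σ₄.mem = φ j := by
      rw [Expr.eval_load, Expr.eval_reg, hj, hinv]; rfl
    simp only [bit, Expr.isTrue_eq, Expr.eval_const]
    rw [Expr.eval_load, Expr.eval_add, Expr.eval_add, Expr.eval_mul, e0, e1, Expr.eval_reg,
      Expr.eval_reg, hreg 11 (by omega), hreg 2 le_rfl, c4.size,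
      min_eq_left (by have := (φ i).isLt; omega)]
    -- Entry `(i, j)` of the matrix of `φ⁻¹βφ` is entry `(φ i, φ j)` of the matrix of `β`, so the
    -- output is copied from the input with permuted indices.
    refine (c4.perm (φ i) (φ j)).trans ?_
    change _ ↔ φ.symm (β (φ i)) = j
    exact ⟨fun h => by rw [h, φ.symm_apply_apply], fun h => by rw [← h, φ.apply_symm_apply]⟩

theorem par_reducible_gi : PolyTimeTuringReducible PAR GI :=
  reducible_of_run involutionProgram isAnswer_involutionProgram

end StructuredRAM

theorem mainTheorem7 : PolyTimeEquivalent PAR GI :=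
  ⟨StructuredRAM.par_reducible_gi, StructuredRAM.gi_reducible_par⟩
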